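/- Let $n\ge 0$ and let $S_n$ be the symmetric group with simple reflections $s_i=(i\ \ i+1)$, $1\le i\le n-1$, and length function $\ell$. Let $\mathcal H$ be the Iwahori--Hecke algebra of $S_n$ over $\mathbb Z[\xi]$ ($\xi$ an indeterminate), that is, the associative unital $\mathbb Z[\xi]$-algebra generated by $\tilde T_{s_1},\dots,\tilde T_{s_{n-1}}$ subject to $\tilde T_{s_i}\tilde T_{s_j}=\tilde T_{s_j}\tilde T_{s_i}$ for $|i-j|\ge 2$, $\tilde T_{s_i}\tilde T_{s_{i+1}}\tilde T_{s_i}=\tilde T_{s_{i+1}}\tilde T_{s_i}\tilde T_{s_{i+1}}$ for $1\le i\le n-2$, and $\tilde T_{s_i}^2=1+\xi\tilde T_{s_i}$ for $1\le i\le n-1$. For $w\in S_n$ with reduced expression $w=s_{i_1}\cdots s_{i_r}$ put $\tilde T_w=\tilde T_{s_{i_1}}\cdots\tilde T_{s_{i_r}}$. For a composition $\lambda=(\lambda_1,\dots,\lambda_r)$ of $n$ (a finite sequence of positive integers with sum $n$), let $S_\lambda=S_{\lambda_1}\times\cdots\times S_{\lambda_r}\le S_n$ be the parabolic subgroup generated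 by the $s_j$ with $j\notin\{\lambda_1,\lambda_1+\lambda_2,\dots,\lambda_1+\cdots+\lambda_{r-1}\}$, let $w_\lambda$ be the product of these $s_j$ in increasing order of $j$, and let $\lambda-1$ be the composition of $n$ obtained from $\lambda$ by replacing each component $\lambda_i>1$ by the two consecutive components $\lambda_i-1,\,1$. For parabolic subgroups $H\le K$ of $S_n$ and $h\in\mathcal H$ define the relative norm \[\mathcal N_{K,H}(h)=\sum_{d\in\mathcal D}\tilde T_{d^{-1}}\,h\,\tilde T_d,\] where $\mathcal D$ is the set of distinguished right coset representatives of $H$ in $K$, i.e. of the $d\in K$ that have minimal length in the coset $Hd$. Put \[\eta_\lambda=\mathcal N_{S_{\lambda-1},1}(\tilde T_{w_\lambda}),\qquad b_\lambda=\mathcal N_{S_n,S_\lambda}(\eta_\lambda).\] If $\alpha$ and $\beta$ are conjugate compositions of $n$, i.e. they have the same components, counted with multiplicity, possibly in a different order, then $b_\alpha=b_\beta$. -/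

import Mathlib

open Polynomial

namespace HeckeNorm

/-! ### The symmetric group -/

/-- The simple reflections of `S_n`, as permutations of `{0, …, n-1}`.
The index `i : Fin (n - 1)` is the usual index minus one: `simpleRefl i` exchanges `i` and `i + 1`. -/
def simpleRefl {n : ℕ} (i : Fin (n - 1)) : Equiv.Perm (Fin n) :=
  Equiv.swap ⟨i, by omega⟩ ⟨i + 1, by omega⟩

/-- The element of `S_n` expressed by a word in the simple reflections. -/
def wordProd {n : ℕ} (l : List (Fin (n - 1))) : Equiv.Perm (Fin n) :=
  (l.map simpleRefl).prod

/-- The simple reflections generate `S_n`. -/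
theorem exists_word {n : ℕ} (w : Equiv.Perm (Fin n)) : ∃ l : List (Fin (n - 1)), wordProd l = w := by
  cases n with
  | zero => exact ⟨[], Subsingleton.elim _ _⟩
  | succ m =>
    have hw : w ∈ Submonoid.closure
        (Set.range fun i : Fin m => Equiv.swap i.castSucc i.succ) := by
      rw [Equiv.Perm.mclosure_swap_castSucc_succ]; trivial
    induction hw using Submonoid.closure_induction with
    | mem x hx =>
      obtain ⟨i, rfl⟩ := hx
      exact ⟨[i], by simp [wordProd, simpleRefl]; rfl⟩
    | one => exact ⟨[], rfl⟩
    | mul x y _ _ hx hy =>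
      obtain ⟨l, rfl⟩ := hx
      obtain ⟨k, rfl⟩ := hy
      exact ⟨l ++ k, by simp [wordProd]⟩

/-- The length of `w`: the least number of simple reflections in an expression for `w`. -/
noncomputable def length {n : ℕ} (w : Equiv.Perm (Fin n)) : ℕ :=
  sInf {k | ∃ l : List (Fin (n - 1)), l.length = k ∧ wordProd l = w}

/-- `l` is a reduced expression for `w`. -/
def IsReducedWord {n : ℕ} (l : List (Fin (n - 1))) (w : Equiv.Perm (Fin n)) : Prop :=
  wordProd l = w ∧ l.length = length w

theorem exists_reducedWord {n : ℕ} (w : Equiv.Perm (Fin n)) :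
    ∃ l : List (Fin (n - 1)), IsReducedWord l w := by
  obtain ⟨l, hl⟩ := exists_word w
  obtain ⟨k, hk, hw⟩ := Nat.sInf_mem
    (s := {k | ∃ l : List (Fin (n - 1)), l.length = k ∧ wordProd l = w}) ⟨l.length, l, rfl, hl⟩
  exact ⟨k, hw, hk⟩

/-- `simpleRefl j` is one of the simple reflections generating the parabolic subgroup of `c`:
`j` and `j + 1` are positions inside one block of `c`. -/
def IsSimpleOf {n : ℕ} (c : Composition n) (j : Fin (n - 1)) : Prop :=
  ∃ i < c.length, c.sizeUpTo i ≤ (j : ℕ) ∧ (j : ℕ) + 1 < c.sizeUpTo (i + 1)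

/-- The parabolic (Young) subgroup `S_c` of `S_n`. -/
def parabolic {n : ℕ} (c : Composition n) : Subgroup (Equiv.Perm (Fin n)) :=
  Subgroup.closure (simpleRefl '' {j | IsSimpleOf c j})

open Classical in
/-- The Coxeter element `w_c` of `S_c`: the product, in increasing order of index, of the simple
reflections that generate `S_c`. -/
noncomputable def coxeterElt {n : ℕ} (c : Composition n) : Equiv.Perm (Fin n) :=
  wordProd ((List.finRange (n - 1)).filter fun j => IsSimpleOf c j)

/-- The replacement of a single component: `k > 1` becomes `k - 1, 1`, and `1` stays. -/
def splitOne (k : ℕ) : List ℕ := if 1 < k then [k - 1, 1] else [k]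

/-- The composition `c - 1` of `n`: every component `k > 1` is replaced by `k - 1, 1`. -/
def subOne {n : ℕ} (c : Composition n) : Composition n where
  blocks := c.blocks.flatMap splitOne
  blocks_pos := by
    intro i hi
    obtain ⟨k, hk, hik⟩ := List.mem_flatMap.1 hi
    have := c.blocks_pos hk
    unfold splitOne at hik
    split_ifs at hik <;> simp at hik <;> omega
  blocks_sum := by
    have h : ∀ l : List ℕ, (l.flatMap splitOne).sum = l.sum := by
      intro l
      induction l with
      | nil => rfl
      | cons k l ih =>
        rw [List.flatMap_cons, List.sum_append, ih, List.sum_cons]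
        congr 1
        unfold splitOne
        split_ifs
        · simp; omega
        · simp
    rw [h, c.blocks_sum]

/-- Two compositions are conjugate if they have the same components, with multiplicity. -/
def Conjugate {n : ℕ} (α β : Composition n) : Prop := α.blocks.Perm β.blocks

open Classical in
/-- The distinguished right coset representatives of `H` in `K`: the elements `d` of `K`
of minimal length in their coset `H d`. -/
noncomputable def rightReps {n : ℕ} (K H : Subgroup (Equiv.Perm (Fin n))) :
    Finset (Equiv.Perm (Fin n)) :=
  Finset.univ.filter fun d => d ∈ K ∧ ∀ u ∈ H, length d ≤ length (u * d)

/-! ### The Hecke algebra -/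

/-- The defining relations of the Iwahori–Hecke algebra of `S_n` over `ℤ[ξ]`; the indeterminate
`ξ` is `X : ℤ[X]`. -/
inductive HeckeRel (n : ℕ) :
    FreeAlgebra ℤ[X] (Fin (n - 1)) → FreeAlgebra ℤ[X] (Fin (n - 1)) → Prop
  | comm (i j : Fin (n - 1)) (h : (i : ℕ) + 2 ≤ j) :
      HeckeRel n (FreeAlgebra.ι ℤ[X] i * FreeAlgebra.ι ℤ[X] j)
        (FreeAlgebra.ι ℤ[X] j * FreeAlgebra.ι ℤ[X] i)
  | braid (i j : Fin (n - 1)) (h : (i : ℕ) + 1 = j) :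
      HeckeRel n (FreeAlgebra.ι ℤ[X] i * FreeAlgebra.ι ℤ[X] j * FreeAlgebra.ι ℤ[X] i)
        (FreeAlgebra.ι ℤ[X] j * FreeAlgebra.ι ℤ[X] i * FreeAlgebra.ι ℤ[X] j)
  | quad (i : Fin (n - 1)) :
      HeckeRel n (FreeAlgebra.ι ℤ[X] i * FreeAlgebra.ι ℤ[X] i)
        (1 + (X : ℤ[X]) • FreeAlgebra.ι ℤ[X] i)

/-- The Iwahori–Hecke algebra of `S_n` over `ℤ[ξ]`, with normalized generators. -/
abbrev Hecke (n : ℕ) : Type := RingQuot (HeckeRel n)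

/-- The normalized generator of the Hecke algebra attached to `simpleRefl i`. -/
noncomputable def gen {n : ℕ} (i : Fin (n - 1)) : Hecke n :=
  RingQuot.mkAlgHom ℤ[X] (HeckeRel n) (FreeAlgebra.ι ℤ[X] i)

/-- The standard basis element `T_w`: the product of the generators along a reduced expression
for `w` (by the braid relations the choice of the reduced expression is immaterial). -/
noncomputable def T {n : ℕ} (w : Equiv.Perm (Fin n)) : Hecke n :=
  ((exists_reducedWord w).choose.map gen).prod

/-! ### Norms -/

/-- The relative norm of `h` from `H` to `K`. -/
noncomputable def relNorm {n : ℕ} (K H : Subgroup (Equiv.Perm (Fin n))) (h : Hecke n) : Hecke n :=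
  ∑ d ∈ rightReps K H, T d⁻¹ * h * T d

/-- The Coxeter class element `η_c`. -/
noncomputable def eta {n : ℕ} (c : Composition n) : Hecke n :=
  relNorm (parabolic (subOne c)) ⊥ (T (coxeterElt c))

/-- The norm `b_α`. -/
noncomputable def b {n : ℕ} (α : Composition n) : Hecke n :=
  relNorm ⊤ (parabolic α) (eta α)

end HeckeNorm


/-!
Write `J` for the set of simple reflections generating `S_α`. The Coxeter class element `η_α` is
the product, over `j ∈ J`, of the Jucys–Murphy elements of the blocks of `α`: adjoining the
generators of `S_{α-1}` one at a time turns each factor of `T_{w_α}` into a Jucys–Murphy element.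
Hence `η_α` commutes with the Hecke algebra of `S_α`.

If `α` and `β` are conjugate, rearranging the blocks is a permutation `σ` such that `σ⁻¹` is
distinguished for `S_α` and `σ` is distinguished for `S_β`, so that
`T_x T_{σ⁻¹} = T_{σ⁻¹} T_{σxσ⁻¹}` for `x ∈ S_α`. Since `σ w_α σ⁻¹ = w_β`, it follows that
`η_α T_{σ⁻¹} = T_{σ⁻¹} η_β`.

Finally, for `h` commuting with the Hecke algebra of `S_α`, the norm from `S_α` to `S_n` is
`∑ x h y` over any pair of dual bases `x`, `y` of `ℋ` over that subalgebra, dual with respect to the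
conditional expectation which kills `T_w` for `w ∉ S_α`. The unit `T_{σ⁻¹}` transports the dual
bases `T_{d⁻¹}`, `T_d` for `S_β` to dual bases for `S_α`, and the two norms agree.
-/

namespace HeckeNorm

open Equiv (Perm)

variable {n : ℕ}

/-! ### Simple reflections, inversions and length -/

/-- The smaller of the two points exchanged by `simpleRefl i`. -/
def lo (i : Fin (n - 1)) : Fin n := ⟨i, by omega⟩

/-- The larger of the two points exchanged by `simpleRefl i`. -/
def hi (i : Fin (n - 1)) : Fin n := ⟨i + 1, by omega⟩

@[simp] theorem lo_val (i : Fin (n - 1)) : (lo i : ℕ) = i := rfl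

@[simp] theorem hi_val (i : Fin (n - 1)) : (hi i : ℕ) = i + 1 := rfl

theorem lo_lt_hi (i : Fin (n - 1)) : lo i < hi i := Fin.lt_def.2 (by simp)

@[simp] theorem simpleRefl_lo (i : Fin (n - 1)) : simpleRefl i (lo i) = hi i :=
  Equiv.swap_apply_left _ _

@[simp] theorem simpleRefl_hi (i : Fin (n - 1)) : simpleRefl i (hi i) = lo i :=
  Equiv.swap_apply_right _ _

@[simp] theorem simpleRefl_inv (i : Fin (n - 1)) : (simpleRefl i)⁻¹ = simpleRefl i :=
  Equiv.swap_inv _ _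

@[simp] theorem simpleRefl_simpleRefl (i : Fin (n - 1)) (a : Fin n) :
    simpleRefl i (simpleRefl i a) = a := Equiv.swap_apply_self _ _ _

@[simp] theorem simpleRefl_mul_cancel_left (i : Fin (n - 1)) (w : Perm (Fin n)) :
    simpleRefl i * (simpleRefl i * w) = w := Equiv.swap_mul_self_mul _ _ _

@[simp] theorem mul_simpleRefl_cancel_right (i : Fin (n - 1)) (w : Perm (Fin n)) :
    w * simpleRefl i * simpleRefl i = w := Equiv.mul_swap_mul_self _ _ _

theorem simpleRefl_val (i : Fin (n - 1)) (a : Fin n) :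
    (simpleRefl i a : ℕ) =
      if (a : ℕ) = i then (i : ℕ) + 1 else if (a : ℕ) = i + 1 then i else a := by
  simp only [simpleRefl, Equiv.swap_apply_def, Fin.ext_iff]
  split_ifs <;> rfl

theorem simpleRefl_of_ne {i : Fin (n - 1)} {a : Fin n} (hlo : a ≠ lo i) (hhi : a ≠ hi i) :
    simpleRefl i a = a := Equiv.swap_apply_of_ne_of_ne hlo hhi

theorem simpleRefl_apply_of_add_two_le {i j : Fin (n - 1)}
    (h : (i : ℕ) + 2 ≤ j ∨ (j : ℕ) + 2 ≤ i) :
    simpleRefl i (lo j) = lo j ∧ simpleRefl i (hi j) = hi j := by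
  constructor <;> refine simpleRefl_of_ne ?_ ?_ <;> rw [Ne, Fin.ext_iff] <;>
    simp only [lo_val, hi_val] <;> omega

theorem simpleRefl_hi_of_add_one_eq {i j : Fin (n - 1)} (h : (i : ℕ) + 1 = j) :
    simpleRefl i (hi j) = hi j := by
  refine simpleRefl_of_ne ?_ ?_ <;> rw [Ne, Fin.ext_iff] <;> simp only [lo_val, hi_val] <;> omega

theorem simpleRefl_lo_of_add_one_eq {i j : Fin (n - 1)} (h : (i : ℕ) + 1 = j) :
    simpleRefl j (lo i) = lo i := by
  refine simpleRefl_of_ne ?_ ?_ <;> rw [Ne, Fin.ext_iff] <;> simp only [lo_val, hi_val] <;> omega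

theorem hi_eq_lo_of_add_one_eq {i j : Fin (n - 1)} (h : (i : ℕ) + 1 = j) : hi i = lo j := Fin.ext h

theorem simpleRefl_lt_simpleRefl {i : Fin (n - 1)} {a b : Fin n} (h : a < b)
    (hne : ¬(a = lo i ∧ b = hi i)) : simpleRefl i a < simpleRefl i b := by
  simp only [Fin.lt_def, Fin.ext_iff, lo_val, hi_val, simpleRefl_val] at h hne ⊢
  split_ifs <;> omega

theorem simpleRefl_comm {i j : Fin (n - 1)} (h : (i : ℕ) + 2 ≤ j) :
    simpleRefl i * simpleRefl j = simpleRefl j * simpleRefl i := by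
  ext a
  simp only [Perm.mul_apply, simpleRefl_val]
  split_ifs <;> omega

theorem simpleRefl_braid {i j : Fin (n - 1)} (h : (i : ℕ) + 1 = j) :
    simpleRefl i * simpleRefl j * simpleRefl i = simpleRefl j * simpleRefl i * simpleRefl j := by
  have hij : hi i = lo j := Fin.ext h
  have hi_swap : simpleRefl i = Equiv.swap (lo i) (lo j) := hij ▸ rfl
  have hj_swap : simpleRefl j = Equiv.swap (lo j) (hi j) := rfl
  have hlt : lo i < lo j := hij ▸ lo_lt_hi i
  rw [hi_swap, hj_swap, Equiv.swap_mul_swap_mul_swap hlt.ne (hlt.trans (lo_lt_hi j)).ne,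
    Equiv.swap_comm (lo i), Equiv.swap_comm (lo j) (hi j),
    Equiv.swap_mul_swap_mul_swap (lo_lt_hi j).ne' (hlt.trans (lo_lt_hi j)).ne', Equiv.swap_comm]

/-- The pairs `a < b` whose order is reversed by `w`; their number turns out to be `length w`. -/
def inversions (w : Perm (Fin n)) : Finset (Fin n × Fin n) :=
  Finset.univ.filter fun p => p.1 < p.2 ∧ w p.2 < w p.1

theorem mem_inversions {w : Perm (Fin n)} {p : Fin n × Fin n} :
    p ∈ inversions w ↔ p.1 < p.2 ∧ w p.2 < w p.1 := by simp [inversions]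

theorem inversions_mul_simpleRefl {w : Perm (Fin n)} {i : Fin (n - 1)} (h : w (lo i) < w (hi i)) :
    inversions (w * simpleRefl i) = insert (lo i, hi i)
      ((inversions w).image (Prod.map (simpleRefl i) (simpleRefl i))) := by
  ext ⟨a, b⟩
  have mem_image : (a, b) ∈ (inversions w).image (Prod.map (simpleRefl i) (simpleRefl i)) ↔
      simpleRefl i a < simpleRefl i b ∧ w (simpleRefl i b) < w (simpleRefl i a) := by
    rw [Finset.mem_image]
    refine ⟨?_, fun h => ⟨(simpleRefl i a, simpleRefl i b), mem_inversions.2 h, by simp⟩⟩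
    rintro ⟨p, hp, hpab⟩
    obtain ⟨rfl, rfl⟩ := Prod.mk.inj hpab
    simpa using mem_inversions.1 hp
  rw [Finset.mem_insert, mem_image, mem_inversions, Prod.mk.injEq]
  by_cases hab : a = lo i ∧ b = hi i
  · obtain ⟨rfl, rfl⟩ := hab
    simpa using ⟨lo_lt_hi i, h⟩
  · refine ⟨fun ⟨h₁, h₂⟩ => Or.inr ⟨simpleRefl_lt_simpleRefl h₁ hab, h₂⟩, fun h' => ?_⟩
    obtain ⟨h₁, h₂⟩ := h'.resolve_left hab
    refine ⟨?_, h₂⟩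
    have hne : ¬(simpleRefl i a = lo i ∧ simpleRefl i b = hi i) := fun ⟨ha, hb⟩ =>
      lt_asymm h (ha ▸ hb ▸ h₂)
    simpa using simpleRefl_lt_simpleRefl h₁ hne

theorem card_inversions_mul_simpleRefl {w : Perm (Fin n)} {i : Fin (n - 1)}
    (h : w (lo i) < w (hi i)) : (inversions (w * simpleRefl i)).card = (inversions w).card + 1 := by
  have hinj : Function.Injective (Prod.map (simpleRefl i) (simpleRefl i)) :=
    (simpleRefl i).injective.prodMap (simpleRefl i).injective
  rw [inversions_mul_simpleRefl h, Finset.card_insert_of_notMem,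
    Finset.card_image_of_injective _ hinj]
  rw [Finset.mem_image]
  rintro ⟨p, hp, hpi⟩
  have hp' : p = (hi i, lo i) := hinj (hpi.trans (by simp))
  exact lt_asymm (lo_lt_hi i) (by simpa [hp'] using (mem_inversions.1 hp).1)

theorem lt_or_gt_lo_hi (w : Perm (Fin n)) (i : Fin (n - 1)) :
    w (lo i) < w (hi i) ∨ w (hi i) < w (lo i) :=
  lt_or_gt_of_ne (w.injective.ne (lo_lt_hi i).ne)

theorem eq_one_of_forall_lo_lt_hi {w : Perm (Fin n)} (h : ∀ i, w (lo i) < w (hi i)) : w = 1 := by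
  cases n with
  | zero => exact Subsingleton.elim _ _
  | succ m =>
    have hw : StrictMono w := Fin.strictMono_iff_lt_succ.2 h
    exact Equiv.coe_fn_injective <|
      (hw.range_inj strictMono_id).1 (w.surjective.range_eq.trans Set.range_id.symm)

@[elab_as_elim]
theorem right_induction {P : Perm (Fin n) → Prop} (one : P 1)
    (mul_simpleRefl : ∀ w i, w (lo i) < w (hi i) → P w → P (w * simpleRefl i))
    (w : Perm (Fin n)) : P w := by
  induction hk : (inversions w).card generalizing w with
  | zero =>
    have hw : ∀ i, w (lo i) < w (hi i) := fun i => (lt_or_gt_lo_hi w i).resolve_right fun hgt =>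
      Finset.notMem_empty (lo i, _) <|
        Finset.card_eq_zero.1 hk ▸ mem_inversions.2 ⟨lo_lt_hi i, hgt⟩
    exact eq_one_of_forall_lo_lt_hi hw ▸ one
  | succ k ih =>
    obtain ⟨i, hgt⟩ : ∃ i, w (hi i) < w (lo i) := by
      by_contra! hw
      have hw1 : w = 1 := eq_one_of_forall_lo_lt_hi fun i =>
        (lt_or_gt_lo_hi w i).resolve_right (hw i).not_gt
      obtain ⟨p, hp⟩ := Finset.card_pos.1 (by omega : 0 < (inversions w).card)
      obtain ⟨h₁, h₂⟩ := mem_inversions.1 hp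
      exact lt_asymm h₁ (by rwa [hw1] at h₂)
    have hlt : (w * simpleRefl i) (lo i) < (w * simpleRefl i) (hi i) := by simpa using hgt
    have hcard := card_inversions_mul_simpleRefl hlt
    rw [mul_simpleRefl_cancel_right] at hcard
    simpa using mul_simpleRefl _ i hlt (ih _ (by omega))

theorem wordProd_cons (i : Fin (n - 1)) (l : List (Fin (n - 1))) :
    wordProd (i :: l) = simpleRefl i * wordProd l := by simp [wordProd]

theorem wordProd_append_singleton (l : List (Fin (n - 1))) (i : Fin (n - 1)) :
    wordProd (l ++ [i]) = wordProd l * simpleRefl i := by simp [wordProd]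

theorem wordProd_reverse (l : List (Fin (n - 1))) : wordProd l.reverse = (wordProd l)⁻¹ := by
  simp [wordProd, List.prod_inv_reverse, List.map_reverse, Function.comp_def]

theorem card_inversions_wordProd_le (l : List (Fin (n - 1))) :
    (inversions (wordProd l)).card ≤ l.length := by
  induction l using List.reverseRecOn with
  | nil =>
    refine (Finset.card_eq_zero.2 (Finset.eq_empty_of_forall_notMem fun p hp => ?_)).le
    exact lt_asymm (mem_inversions.1 hp).1 (mem_inversions.1 hp).2
  | append_singleton l i ih =>
    rw [wordProd_append_singleton, List.length_append, List.length_singleton]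
    rcases lt_or_gt_lo_hi (wordProd l) i with h | h
    · rw [card_inversions_mul_simpleRefl h]
      omega
    · have := card_inversions_mul_simpleRefl (w := wordProd l * simpleRefl i) (i := i) (by simpa)
      rw [mul_simpleRefl_cancel_right] at this
      omega

theorem exists_word_length_eq_card_inversions (w : Perm (Fin n)) :
    ∃ l : List (Fin (n - 1)), wordProd l = w ∧ l.length = (inversions w).card := by
  induction w using right_induction with
  | one =>
    exact ⟨[], rfl, (Nat.le_zero.1 (card_inversions_wordProd_le [])).symm⟩
  | mul_simpleRefl w i h ih =>
    obtain ⟨l, rfl, hl⟩ := ih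
    exact ⟨l ++ [i], wordProd_append_singleton l i, by
      rw [card_inversions_mul_simpleRefl h, ← hl, List.length_append, List.length_singleton]⟩

theorem length_wordProd_le (l : List (Fin (n - 1))) : length (wordProd l) ≤ l.length :=
  Nat.sInf_le ⟨l, rfl, rfl⟩

theorem length_eq_card_inversions (w : Perm (Fin n)) : length w = (inversions w).card := by
  apply le_antisymm
  · obtain ⟨l, rfl, hl⟩ := exists_word_length_eq_card_inversions w
    exact hl ▸ length_wordProd_le l
  · obtain ⟨l, rfl, hl⟩ := exists_reducedWord w
    exact hl ▸ card_inversions_wordProd_le l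

theorem length_inv_le (w : Perm (Fin n)) : length w⁻¹ ≤ length w := by
  obtain ⟨l, rfl, hl⟩ := exists_reducedWord w
  rw [← hl, ← wordProd_reverse, ← List.length_reverse]
  exact length_wordProd_le _

@[simp] theorem length_inv (w : Perm (Fin n)) : length w⁻¹ = length w :=
  le_antisymm (length_inv_le w) (by simpa using length_inv_le w⁻¹)

@[simp] theorem length_one : length (1 : Perm (Fin n)) = 0 :=
  Nat.le_zero.1 (length_wordProd_le [])

theorem length_mul_simpleRefl {w : Perm (Fin n)} {i : Fin (n - 1)} (h : w (lo i) < w (hi i)) :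
    length (w * simpleRefl i) = length w + 1 := by
  simp only [length_eq_card_inversions, card_inversions_mul_simpleRefl h]

theorem length_simpleRefl_mul {w : Perm (Fin n)} {i : Fin (n - 1)}
    (h : w⁻¹ (lo i) < w⁻¹ (hi i)) : length (simpleRefl i * w) = length w + 1 := by
  rw [← length_inv, mul_inv_rev, simpleRefl_inv, length_mul_simpleRefl h, length_inv]

theorem inv_lo_lt_inv_hi_simpleRefl_mul {w : Perm (Fin n)} {i : Fin (n - 1)} :
    (simpleRefl i * w)⁻¹ (lo i) < (simpleRefl i * w)⁻¹ (hi i) ↔ w⁻¹ (hi i) < w⁻¹ (lo i) := by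
  simp only [mul_inv_rev, simpleRefl_inv, Perm.mul_apply, simpleRefl_lo, simpleRefl_hi]

theorem length_eq_length_simpleRefl_mul_add_one {w : Perm (Fin n)} {i : Fin (n - 1)}
    (h : w⁻¹ (hi i) < w⁻¹ (lo i)) : length w = length (simpleRefl i * w) + 1 := by
  rw [← length_simpleRefl_mul (inv_lo_lt_inv_hi_simpleRefl_mul.2 h), simpleRefl_mul_cancel_left]

@[elab_as_elim]
theorem left_induction {P : Perm (Fin n) → Prop} (one : P 1)
    (simpleRefl_mul : ∀ w i, w⁻¹ (lo i) < w⁻¹ (hi i) → P w → P (simpleRefl i * w))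
    (w : Perm (Fin n)) : P w := by
  suffices ∀ w : Perm (Fin n), P w⁻¹ from inv_inv w ▸ this w⁻¹
  intro w
  induction w using right_induction with
  | one => exact inv_one (G := Perm (Fin n)) ▸ one
  | mul_simpleRefl w i h ih =>
    rw [mul_inv_rev, simpleRefl_inv]
    exact simpleRefl_mul _ i (by rwa [inv_inv]) ih

/-! ### Matsumoto's theorem -/

theorem isReducedWord_cons {i : Fin (n - 1)} {l : List (Fin (n - 1))} {w : Perm (Fin n)} :
    IsReducedWord (i :: l) w ↔ IsReducedWord l (simpleRefl i * w) ∧ w⁻¹ (hi i) < w⁻¹ (lo i) := by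
  have hprod : wordProd (i :: l) = w ↔ wordProd l = simpleRefl i * w := by
    rw [wordProd_cons, ← eq_inv_mul_iff_mul_eq, simpleRefl_inv]
  rw [IsReducedWord, IsReducedWord, hprod, List.length_cons, and_assoc]
  refine and_congr_right fun hl => ?_
  rcases lt_or_gt_lo_hi w⁻¹ i with h | h
  · have hle := length_wordProd_le l
    rw [hl, length_simpleRefl_mul h] at hle
    exact iff_of_false (by omega) fun hgt => lt_asymm h hgt.2
  · rw [length_eq_length_simpleRefl_mul_add_one h, Nat.add_right_cancel_iff]
    exact (and_iff_left h).symm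

section Matsumoto

variable {M : Type*} [Monoid M] {f : Fin (n - 1) → M} {i j : Fin (n - 1)} {w : Perm (Fin n)}

theorem exists_isReducedWord_cons_of_add_two_le (hij : (i : ℕ) + 2 ≤ j)
    (hcomm : f i * f j = f j * f i) (hi_desc : w⁻¹ (hi i) < w⁻¹ (lo i))
    (hj_desc : w⁻¹ (hi j) < w⁻¹ (lo j)) :
    ∃ l l', IsReducedWord (i :: l) w ∧ IsReducedWord (j :: l') w ∧
      ((i :: l).map f).prod = ((j :: l').map f).prod := by
  obtain ⟨r, hr⟩ := exists_reducedWord (simpleRefl j * (simpleRefl i * w))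
  have hr' : IsReducedWord r (simpleRefl i * (simpleRefl j * w)) := by
    rwa [← mul_assoc, simpleRefl_comm hij, mul_assoc]
  obtain ⟨hi_lo, hi_hi⟩ := simpleRefl_apply_of_add_two_le (Or.inl hij)
  obtain ⟨hj_lo, hj_hi⟩ := simpleRefl_apply_of_add_two_le (i := j) (j := i) (Or.inr hij)
  refine ⟨j :: r, i :: r, ?_, ?_, ?_⟩
  · exact isReducedWord_cons.2 ⟨isReducedWord_cons.2 ⟨hr, by simpa [hi_lo, hi_hi]⟩, hi_desc⟩
  · exact isReducedWord_cons.2 ⟨isReducedWord_cons.2 ⟨hr', by simpa [hj_lo, hj_hi]⟩, hj_desc⟩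
  · simp only [List.map_cons, List.prod_cons, ← mul_assoc, hcomm]

theorem exists_isReducedWord_cons_of_add_one_eq (hij : (i : ℕ) + 1 = j)
    (hbraid : f i * f j * f i = f j * f i * f j) (hi_desc : w⁻¹ (hi i) < w⁻¹ (lo i))
    (hj_desc : w⁻¹ (hi j) < w⁻¹ (lo j)) :
    ∃ l l', IsReducedWord (i :: l) w ∧ IsReducedWord (j :: l') w ∧
      ((i :: l).map f).prod = ((j :: l').map f).prod := by
  obtain ⟨r, hr⟩ := exists_reducedWord (simpleRefl i * (simpleRefl j * (simpleRefl i * w)))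
  have hr' : IsReducedWord r (simpleRefl j * (simpleRefl i * (simpleRefl j * w))) := by
    have := simpleRefl_braid hij
    simp only [← mul_assoc] at hr ⊢
    rwa [← this]
  have hi_hi := simpleRefl_hi_of_add_one_eq hij
  have hj_lo := simpleRefl_lo_of_add_one_eq hij
  have hi_lo : simpleRefl i (lo j) = lo i := by
    rw [← hi_eq_lo_of_add_one_eq hij, simpleRefl_hi]
  rw [hi_eq_lo_of_add_one_eq hij] at hi_desc
  have hlt := hj_desc.trans hi_desc
  refine ⟨j :: i :: r, i :: j :: r, ?_, ?_, ?_⟩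
  · refine isReducedWord_cons.2 ⟨isReducedWord_cons.2 ⟨isReducedWord_cons.2 ⟨hr, ?_⟩, ?_⟩, ?_⟩
    · simpa [hi_eq_lo_of_add_one_eq hij, hj_lo, hi_hi] using hj_desc
    · simpa [hi_lo, hi_hi] using hlt
    · rwa [hi_eq_lo_of_add_one_eq hij]
  · refine isReducedWord_cons.2 ⟨isReducedWord_cons.2 ⟨isReducedWord_cons.2 ⟨hr', ?_⟩, ?_⟩, hj_desc⟩
    · simpa [hj_lo, hi_hi, hi_lo] using hi_desc
    · simpa [hi_eq_lo_of_add_one_eq hij, hj_lo] using hlt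
  · simp only [List.map_cons, List.prod_cons, ← mul_assoc, hbraid]

theorem exists_isReducedWord_cons
    (hcomm : ∀ i j : Fin (n - 1), (i : ℕ) + 2 ≤ j → f i * f j = f j * f i)
    (hbraid : ∀ i j : Fin (n - 1), (i : ℕ) + 1 = j → f i * f j * f i = f j * f i * f j)
    (hi_desc : w⁻¹ (hi i) < w⁻¹ (lo i)) (hj_desc : w⁻¹ (hi j) < w⁻¹ (lo j)) :
    ∃ l l', IsReducedWord (i :: l) w ∧ IsReducedWord (j :: l') w ∧
      ((i :: l).map f).prod = ((j :: l').map f).prod := by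
  wlog hij : (i : ℕ) ≤ j generalizing i j
  · obtain ⟨l, l', hl, hl', heq⟩ := this hj_desc hi_desc (by omega)
    exact ⟨l', l, hl', hl, heq.symm⟩
  obtain hij | hij | hij : i = j ∨ (i : ℕ) + 1 = j ∨ (i : ℕ) + 2 ≤ j := by
    rw [Fin.ext_iff]
    omega
  · subst hij
    obtain ⟨l, hl⟩ := exists_reducedWord (simpleRefl i * w)
    have hil := isReducedWord_cons.2 ⟨hl, hi_desc⟩
    exact ⟨l, l, hil, hil, rfl⟩
  · exact exists_isReducedWord_cons_of_add_one_eq hij (hbraid i j hij) hi_desc hj_desc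
  · exact exists_isReducedWord_cons_of_add_two_le hij (hcomm i j hij) hi_desc hj_desc

theorem prod_map_eq_of_isReducedWord
    (hcomm : ∀ i j : Fin (n - 1), (i : ℕ) + 2 ≤ j → f i * f j = f j * f i)
    (hbraid : ∀ i j : Fin (n - 1), (i : ℕ) + 1 = j → f i * f j * f i = f j * f i * f j)
    {l l' : List (Fin (n - 1))} (hl : IsReducedWord l w) (hl' : IsReducedWord l' w) :
    (l.map f).prod = (l'.map f).prod := by
  induction hk : length w generalizing w l l' with
  | zero =>
    rw [List.length_eq_zero_iff.1 (hl.2.trans hk), List.length_eq_zero_iff.1 (hl'.2.trans hk)]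
  | succ k ih =>
    obtain ⟨i, l, rfl⟩ := List.exists_cons_of_length_eq_add_one (hl.2.trans hk)
    obtain ⟨j, l', rfl⟩ := List.exists_cons_of_length_eq_add_one (hl'.2.trans hk)
    obtain ⟨hl_tail, hi_desc⟩ := isReducedWord_cons.1 hl
    obtain ⟨hl'_tail, hj_desc⟩ := isReducedWord_cons.1 hl'
    obtain ⟨r, r', hr, hr', heq⟩ := exists_isReducedWord_cons hcomm hbraid hi_desc hj_desc
    have hki := length_eq_length_simpleRefl_mul_add_one hi_desc
    have hkj := length_eq_length_simpleRefl_mul_add_one hj_desc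
    rw [List.map_cons, List.prod_cons, List.map_cons, List.prod_cons] at heq ⊢
    rw [ih hl_tail (isReducedWord_cons.1 hr).1 (by omega), heq,
      ih hl'_tail (isReducedWord_cons.1 hr').1 (by omega)]

end Matsumoto

/-! ### The standard basis -/

theorem gen_comm {i j : Fin (n - 1)} (h : (i : ℕ) + 2 ≤ j) :
    (gen i * gen j : Hecke n) = gen j * gen i := by
  simp only [gen, ← map_mul]
  exact RingQuot.mkAlgHom_rel _ (HeckeRel.comm i j h)

theorem gen_braid {i j : Fin (n - 1)} (h : (i : ℕ) + 1 = j) :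
    (gen i * gen j * gen i : Hecke n) = gen j * gen i * gen j := by
  simp only [gen, ← map_mul]
  exact RingQuot.mkAlgHom_rel _ (HeckeRel.braid i j h)

theorem gen_mul_self (i : Fin (n - 1)) : (gen i * gen i : Hecke n) = 1 + (X : ℤ[X]) • gen i := by
  simpa [gen] using RingQuot.mkAlgHom_rel ℤ[X] (HeckeRel.quad i)

theorem T_eq_of_isReducedWord {l : List (Fin (n - 1))} {w : Perm (Fin n)}
    (h : IsReducedWord l w) : T w = (l.map gen).prod :=
  prod_map_eq_of_isReducedWord (fun _ _ => gen_comm) (fun _ _ => gen_braid)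
    (exists_reducedWord w).choose_spec h

@[simp] theorem T_one : T (1 : Perm (Fin n)) = 1 :=
  T_eq_of_isReducedWord (l := []) ⟨rfl, by simp⟩

theorem T_mul_simpleRefl {w : Perm (Fin n)} {i : Fin (n - 1)} (h : w (lo i) < w (hi i)) :
    T (w * simpleRefl i) = T w * gen i := by
  obtain ⟨l, rfl, hl⟩ := exists_reducedWord w
  have hli : IsReducedWord (l ++ [i]) (wordProd l * simpleRefl i) :=
    ⟨wordProd_append_singleton l i, by
      rw [length_mul_simpleRefl h, List.length_append, hl, List.length_singleton]⟩
  rw [T_eq_of_isReducedWord hli, T_eq_of_isReducedWord ⟨rfl, hl⟩, List.map_append,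
    List.prod_append, List.map_singleton, List.prod_singleton]

theorem T_simpleRefl_mul {w : Perm (Fin n)} {i : Fin (n - 1)} (h : w⁻¹ (lo i) < w⁻¹ (hi i)) :
    T (simpleRefl i * w) = gen i * T w := by
  obtain ⟨l, hl⟩ := exists_reducedWord w
  have hil : IsReducedWord (i :: l) (simpleRefl i * w) :=
    isReducedWord_cons.2 ⟨by simpa using hl, by simpa using h⟩
  rw [T_eq_of_isReducedWord hil, T_eq_of_isReducedWord hl, List.map_cons, List.prod_cons]

theorem gen_mul_T_of_gt {w : Perm (Fin n)} {i : Fin (n - 1)} (h : w⁻¹ (hi i) < w⁻¹ (lo i)) :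
    gen i * T w = T (simpleRefl i * w) + (X : ℤ[X]) • T w := by
  have hT := T_simpleRefl_mul (inv_lo_lt_inv_hi_simpleRefl_mul.2 h)
  rw [simpleRefl_mul_cancel_left] at hT
  rw [hT, ← mul_assoc, gen_mul_self, add_mul, one_mul, smul_mul_assoc]

theorem isUnit_gen (i : Fin (n - 1)) : IsUnit (gen i : Hecke n) := by
  refine ⟨⟨gen i, gen i + (-X : ℤ[X]) • 1, ?_, ?_⟩, rfl⟩
  · rw [mul_add, gen_mul_self, mul_smul_comm, mul_one, add_assoc, ← add_smul, add_neg_cancel,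
      zero_smul, add_zero]
  · rw [add_mul, gen_mul_self, smul_mul_assoc, one_mul, add_assoc, ← add_smul, add_neg_cancel,
      zero_smul, add_zero]

theorem isUnit_T (w : Perm (Fin n)) : IsUnit (T w) := by
  induction w using right_induction with
  | one => simp
  | mul_simpleRefl w i h ih => exact T_mul_simpleRefl h ▸ ih.mul (isUnit_gen i)

/-! ### The regular representation and the symmetrizing trace -/

/-- Left multiplication by `gen i` in the basis of the `T w`, as an operator on the free module
over `S_n`; these operators show that the `T w` are linearly independent. -/
noncomputable def leftOp (i : Fin (n - 1)) : Module.End ℤ[X] (Perm (Fin n) →₀ ℤ[X]) :=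
  Finsupp.linearCombination ℤ[X] fun w =>
    Finsupp.single (simpleRefl i * w) 1 +
      if w⁻¹ (hi i) < w⁻¹ (lo i) then (X : ℤ[X]) • Finsupp.single w 1 else 0

theorem leftOp_single_of_lt {i : Fin (n - 1)} {w : Perm (Fin n)} (h : w⁻¹ (lo i) < w⁻¹ (hi i)) :
    leftOp i (Finsupp.single w 1) = Finsupp.single (simpleRefl i * w) 1 := by
  rw [leftOp, Finsupp.linearCombination_single, one_smul, if_neg h.not_gt, add_zero]

theorem leftOp_single_of_gt {i : Fin (n - 1)} {w : Perm (Fin n)} (h : w⁻¹ (hi i) < w⁻¹ (lo i)) :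
    leftOp i (Finsupp.single w 1) =
      Finsupp.single (simpleRefl i * w) 1 + (X : ℤ[X]) • Finsupp.single w 1 := by
  rw [leftOp, Finsupp.linearCombination_single, one_smul, if_pos h]

theorem leftOp_mul_self (i : Fin (n - 1)) :
    leftOp i * leftOp i = 1 + (X : ℤ[X]) • leftOp i := by
  refine Finsupp.lhom_ext' fun w => LinearMap.ext_ring ?_
  change leftOp i (leftOp i (.single w 1)) = .single w 1 + (X : ℤ[X]) • leftOp i (.single w 1)
  rcases lt_or_gt_lo_hi w⁻¹ i with h | h
  · rw [leftOp_single_of_lt h, leftOp_single_of_gt (by simpa using h), simpleRefl_mul_cancel_left]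
  · rw [leftOp_single_of_gt h, map_add, map_smul, leftOp_single_of_lt (by simpa using h),
      simpleRefl_mul_cancel_left, leftOp_single_of_gt h]

section Quadratic

variable {k V : Type*} [Semiring k] [AddCommMonoid V] [Module k V] {A B : V →ₗ[k] V} {z : k} {v : V}

theorem comm_apply_of_quadratic (hA : ∀ u, A (A u) = u + z • A u) (hv : A (B v) = B (A v)) :
    A (B (A v)) = B (A (A v)) := by
  rw [← hv, hA, hA, map_add, map_smul, hv]

theorem braid_apply_of_quadratic (hA : ∀ u, A (A u) = u + z • A u)
    (hB : ∀ u, B (B u) = u + z • B u) (hv : A (B (A v)) = B (A (B v))) :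
    A (B (A (A v))) = B (A (B (A v))) := by
  rw [hA, hv, hB, map_add, map_add, map_smul, map_smul, hv]

end Quadratic

theorem end_ext_of_leftOp {i j : Fin (n - 1)} {F G : Module.End ℤ[X] (Perm (Fin n) →₀ ℤ[X])}
    (base : ∀ w : Perm (Fin n), w⁻¹ (lo i) < w⁻¹ (hi i) → w⁻¹ (lo j) < w⁻¹ (hi j) →
      F (.single w 1) = G (.single w 1))
    (leftOp_i : ∀ v, F v = G v → F (leftOp i v) = G (leftOp i v))
    (leftOp_j : ∀ v, F v = G v → F (leftOp j v) = G (leftOp j v)) : F = G := by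
  refine Finsupp.lhom_ext' fun w => LinearMap.ext_ring ?_
  change F (.single w 1) = G (.single w 1)
  induction hk : length w using Nat.strong_induction_on generalizing w with
  | _ k ih =>
    have single_eq : ∀ {l}, w⁻¹ (hi l) < w⁻¹ (lo l) →
        .single w 1 = leftOp l (.single (simpleRefl l * w) 1) := fun hl => by
      rw [leftOp_single_of_lt (inv_lo_lt_inv_hi_simpleRefl_mul.2 hl), simpleRefl_mul_cancel_left]
    have length_lt : ∀ {l}, w⁻¹ (hi l) < w⁻¹ (lo l) → length (simpleRefl l * w) < k := fun hl => by
      rw [← hk, length_eq_length_simpleRefl_mul_add_one hl]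
      exact Nat.lt_succ_self _
    rcases lt_or_gt_lo_hi w⁻¹ i with hwi | hwi
    · rcases lt_or_gt_lo_hi w⁻¹ j with hwj | hwj
      · exact base w hwi hwj
      · exact single_eq hwj ▸ leftOp_j _ (ih _ (length_lt hwj) _ rfl)
    · exact single_eq hwi ▸ leftOp_i _ (ih _ (length_lt hwi) _ rfl)

theorem leftOp_leftOp (i : Fin (n - 1)) (v : Perm (Fin n) →₀ ℤ[X]) :
    leftOp i (leftOp i v) = v + (X : ℤ[X]) • leftOp i v :=
  LinearMap.congr_fun (leftOp_mul_self i) v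

theorem leftOp_comm {i j : Fin (n - 1)} (hij : (i : ℕ) + 2 ≤ j) :
    leftOp i * leftOp j = leftOp j * leftOp i := by
  refine end_ext_of_leftOp (i := i) (j := j) (fun w hwi hwj => ?_)
    (fun v => comm_apply_of_quadratic (leftOp_leftOp i))
    (fun v hv => (comm_apply_of_quadratic (leftOp_leftOp j) hv.symm).symm)
  obtain ⟨hi_lo, hi_hi⟩ := simpleRefl_apply_of_add_two_le (Or.inl hij)
  obtain ⟨hj_lo, hj_hi⟩ := simpleRefl_apply_of_add_two_le (i := j) (j := i) (Or.inr hij)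
  rw [Module.End.mul_apply, Module.End.mul_apply, leftOp_single_of_lt hwi, leftOp_single_of_lt hwj,
    leftOp_single_of_lt (by simpa [hj_lo, hj_hi]), leftOp_single_of_lt (by simpa [hi_lo, hi_hi]),
    ← mul_assoc, simpleRefl_comm hij, mul_assoc]

theorem leftOp_braid {i j : Fin (n - 1)} (hij : (i : ℕ) + 1 = j) :
    leftOp i * leftOp j * leftOp i = leftOp j * leftOp i * leftOp j := by
  refine end_ext_of_leftOp (i := i) (j := j) (fun w hwi hwj => ?_)
    (fun v => braid_apply_of_quadratic (leftOp_leftOp i) (leftOp_leftOp j))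
    (fun v hv => (braid_apply_of_quadratic (leftOp_leftOp j) (leftOp_leftOp i) hv.symm).symm)
  have hi_hi := simpleRefl_hi_of_add_one_eq hij
  have hj_lo := simpleRefl_lo_of_add_one_eq hij
  have hi_lo : simpleRefl i (lo j) = lo i := by
    rw [← hi_eq_lo_of_add_one_eq hij, simpleRefl_hi]
  have hi_eq := hi_eq_lo_of_add_one_eq hij
  have hlt := hwi.trans (hi_eq ▸ hwj)
  simp only [Module.End.mul_apply]
  rw [leftOp_single_of_lt hwi, leftOp_single_of_lt hwj,
    leftOp_single_of_lt (by simpa [hi_lo, hi_hi] using hlt),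
    leftOp_single_of_lt (by simpa [hi_eq, hj_lo, hi_hi] using hwj),
    leftOp_single_of_lt (by simpa [hi_eq, hj_lo] using hlt),
    leftOp_single_of_lt (by simpa [hj_lo, hi_hi, hi_lo, hi_eq] using hwi)]
  simp only [← mul_assoc, simpleRefl_braid hij]

/-- The left regular representation of the Hecke algebra, in the basis of the `T w`. -/
noncomputable def regularRep (n : ℕ) :
    Hecke n →ₐ[ℤ[X]] Module.End ℤ[X] (Perm (Fin n) →₀ ℤ[X]) :=
  RingQuot.liftAlgHom ℤ[X] ⟨FreeAlgebra.lift ℤ[X] leftOp, by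
    intro x y h
    cases h with
    | comm i j h => simpa using leftOp_comm h
    | braid i j h => simpa using leftOp_braid h
    | quad i => simpa using leftOp_mul_self i⟩

theorem regularRep_gen (i : Fin (n - 1)) : regularRep n (gen i) = leftOp i := by
  simp [regularRep, gen]

theorem regularRep_T_single_one (w : Perm (Fin n)) :
    regularRep n (T w) (Finsupp.single 1 1) = Finsupp.single w 1 := by
  induction w using left_induction with
  | one => simp
  | simpleRefl_mul w i h ih =>
    rw [T_simpleRefl_mul h, map_mul, Module.End.mul_apply, ih, regularRep_gen,
      leftOp_single_of_lt h]

/-- The symmetrizing trace of the Hecke algebra: the coefficient of `T 1`. -/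
noncomputable def trace (n : ℕ) : Hecke n →ₗ[ℤ[X]] ℤ[X] :=
  Finsupp.lapply 1 ∘ₗ LinearMap.applyₗ (Finsupp.single 1 1) ∘ₗ (regularRep n).toLinearMap

theorem trace_T (w : Perm (Fin n)) : trace n (T w) = if w = 1 then 1 else 0 := by
  simp [trace, regularRep_T_single_one, Finsupp.single_apply]

theorem trace_T_mul_T (x y : Perm (Fin n)) :
    trace n (T x * T y) = if x * y = 1 then 1 else 0 := by
  induction x using right_induction generalizing y with
  | one => simp [trace_T]
  | mul_simpleRefl x i h ih =>
    rw [T_mul_simpleRefl h, mul_assoc]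
    rcases lt_or_gt_lo_hi y⁻¹ i with hy | hy
    · rw [← T_simpleRefl_mul hy, ih, mul_assoc]
    · have hxy : x * y ≠ 1 := fun hxy => by
        rw [← eq_inv_iff_mul_eq_one.2 hxy] at hy
        exact lt_asymm h hy
      rw [gen_mul_T_of_gt hy, mul_add, map_add, ih, mul_smul_comm, map_smul, ih, mul_assoc,
        if_neg hxy, smul_zero, add_zero]

theorem gen_mul_mem_span_T (i : Fin (n - 1)) {h : Hecke n}
    (hh : h ∈ Submodule.span ℤ[X] (Set.range (T (n := n)))) :
    gen i * h ∈ Submodule.span ℤ[X] (Set.range (T (n := n))) := by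
  induction hh using Submodule.span_induction with
  | mem x hx =>
    obtain ⟨w, rfl⟩ := hx
    rcases lt_or_gt_lo_hi w⁻¹ i with hw | hw
    · rw [← T_simpleRefl_mul hw]
      exact Submodule.subset_span ⟨_, rfl⟩
    · rw [gen_mul_T_of_gt hw]
      exact add_mem (Submodule.subset_span ⟨_, rfl⟩)
        (Submodule.smul_mem _ _ (Submodule.subset_span ⟨_, rfl⟩))
  | zero => simp
  | add x y _ _ hx hy => exact mul_add (gen i) x y ▸ add_mem hx hy
  | smul r x _ hx => exact mul_smul_comm r (gen i) x ▸ Submodule.smul_mem _ r hx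

theorem span_T (n : ℕ) : Submodule.span ℤ[X] (Set.range (T (n := n))) = ⊤ := by
  suffices ∀ a : FreeAlgebra ℤ[X] (Fin (n - 1)), ∀ h ∈ Submodule.span ℤ[X] (Set.range (T (n := n))),
      RingQuot.mkAlgHom ℤ[X] (HeckeRel n) a * h ∈ Submodule.span ℤ[X] (Set.range (T (n := n))) by
    refine eq_top_iff.2 fun h _ => ?_
    obtain ⟨a, rfl⟩ := RingQuot.mkAlgHom_surjective ℤ[X] (HeckeRel n) h
    simpa using this a 1 (Submodule.subset_span ⟨1, T_one⟩)
  intro a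
  induction a using FreeAlgebra.induction with
  | grade0 r =>
    intro h hh
    rw [AlgHom.commutes, ← Algebra.smul_def]
    exact Submodule.smul_mem _ _ hh
  | grade1 i => exact fun h => gen_mul_mem_span_T i
  | mul a b ha hb =>
    intro h hh
    rw [map_mul, mul_assoc]
    exact ha _ (hb _ hh)
  | add a b ha hb =>
    intro h hh
    rw [map_add, add_mul]
    exact add_mem (ha _ hh) (hb _ hh)

theorem linearMap_ext_T {M : Type*} [AddCommMonoid M] [Module ℤ[X] M] {f g : Hecke n →ₗ[ℤ[X]] M}
    (h : ∀ w, f (T w) = g (T w)) : f = g :=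
  LinearMap.ext_on_range (span_T n) h

theorem trace_mul_comm (a b : Hecke n) : trace n (a * b) = trace n (b * a) := by
  suffices (LinearMap.mul ℤ[X] (Hecke n)).compr₂ (trace n) =
      (LinearMap.mul ℤ[X] (Hecke n)).flip.compr₂ (trace n) from
    LinearMap.congr_fun₂ this a b
  refine linearMap_ext_T fun x => linearMap_ext_T fun y => ?_
  simpa [trace_T_mul_T] using if_congr mul_eq_one_comm rfl rfl

theorem sum_trace_T_mul_smul_T_inv (a : Hecke n) : ∑ w, trace n (T w * a) • T w⁻¹ = a := by
  suffices ∑ w, (trace n ∘ₗ LinearMap.mulLeft ℤ[X] (T w)).smulRight (T w⁻¹) = LinearMap.id by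
    simpa using LinearMap.congr_fun this a
  refine linearMap_ext_T fun y => ?_
  simp [trace_T_mul_T, mul_eq_one_iff_eq_inv, ite_smul]

/-! ### Young subgroups and distinguished coset representatives -/

/-- The Young subgroup of `S_n` generated by the `simpleRefl j` with `j ∈ J`, described as the
group of permutations preserving every initial segment `{0, …, j}` with `j ∉ J`. -/
def young (n : ℕ) (J : Set ℕ) : Subgroup (Perm (Fin n)) where
  carrier := {x | ∀ j ∉ J, ∀ a : Fin n, (x a : ℕ) ≤ j ↔ (a : ℕ) ≤ j}
  one_mem' := fun _ _ _ => Iff.rfl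
  mul_mem' := fun {_ y} hx hy j hj a => (hx j hj (y a)).trans (hy j hj a)
  inv_mem' := fun {x} hx j hj a => by simpa using (hx j hj (x⁻¹ a)).symm

section Young

variable {J J' : Set ℕ} {x d : Perm (Fin n)} {i : Fin (n - 1)}

theorem young_mono (h : J ⊆ J') : young n J ≤ young n J' :=
  fun _ hx j hj => hx j fun hjJ => hj (h hjJ)

theorem simpleRefl_mem_young (hiJ : (i : ℕ) ∈ J) : simpleRefl i ∈ young n J := by
  intro j hj a
  have hij : (i : ℕ) ≠ j := fun h => hj (h ▸ hiJ)
  rw [simpleRefl_val]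
  split_ifs <;> omega

theorem mem_of_mem_young_of_gt (hx : x ∈ young n J) (h : x (hi i) < x (lo i)) : (i : ℕ) ∈ J := by
  by_contra hiJ
  have hlo := (hx i hiJ (lo i)).2 le_rfl
  have hhi := mt (hx i hiJ (hi i)).1 (by simp)
  rw [Fin.lt_def] at h
  omega

theorem apply_eq_self_of_mem_young (hx : x ∈ young n J) {a : Fin n} (ha : (a : ℕ) ∉ J)
    (hpred : ∀ j, j + 1 = (a : ℕ) → j ∉ J) : x a = a := by
  have hle := (hx a ha a).2 le_rfl
  refine Fin.ext (hle.antisymm (not_lt.1 fun hlt => ?_))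
  obtain ⟨j, hj⟩ : ∃ j, j + 1 = (a : ℕ) := ⟨a - 1, by omega⟩
  have := (hx j (hpred j hj) a).1 (by omega)
  omega

theorem wordProd_mem_young {l : List (Fin (n - 1))} (hl : ∀ i ∈ l, (i : ℕ) ∈ J) :
    wordProd l ∈ young n J := by
  refine list_prod_mem fun x hx => ?_
  obtain ⟨i, hi, rfl⟩ := List.mem_map.1 hx
  exact simpleRefl_mem_young (hl i hi)

@[elab_as_elim]
theorem young_induction {P : (x : Perm (Fin n)) → x ∈ young n J → Prop} (one : P 1 (one_mem _))
    (simpleRefl_mul : ∀ x (i : Fin (n - 1)) (hx : x ∈ young n J) (hiJ : (i : ℕ) ∈ J),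
      x⁻¹ (lo i) < x⁻¹ (hi i) → P x hx →
        P (simpleRefl i * x) (mul_mem (simpleRefl_mem_young hiJ) hx))
    {x : Perm (Fin n)} (hx : x ∈ young n J) : P x hx := by
  induction x using left_induction with
  | one => exact one
  | simpleRefl_mul x i h ih =>
    have hiJ : (i : ℕ) ∈ J := mem_of_mem_young_of_gt (inv_mem hx) (by simpa using h)
    have hxJ : x ∈ young n J := (Subgroup.mul_mem_cancel_left _ (simpleRefl_mem_young hiJ)).1 hx
    exact simpleRefl_mul x i hxJ hiJ h (ih hxJ)

theorem young_eq_closure (n : ℕ) (J : Set ℕ) :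
    young n J = Subgroup.closure (simpleRefl '' {i : Fin (n - 1) | (i : ℕ) ∈ J}) := by
  refine le_antisymm (fun x hx => ?_) ((Subgroup.closure_le _).2 ?_)
  · induction hx using young_induction with
    | one => exact one_mem _
    | simpleRefl_mul x i _ hiJ _ ih =>
      exact mul_mem (Subgroup.subset_closure ⟨i, hiJ, rfl⟩) ih
  · rintro _ ⟨i, hiJ, rfl⟩
    exact simpleRefl_mem_young hiJ

theorem young_empty (n : ℕ) : young n ∅ = ⊥ := by simp [young_eq_closure]

theorem commute_T_of_mem_young {y : Hecke n}
    (hy : ∀ i : Fin (n - 1), (i : ℕ) ∈ J → Commute y (gen i)) (hx : x ∈ young n J) :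
    Commute y (T x) := by
  induction hx using young_induction with
  | one => exact T_one (n := n) ▸ Commute.one_right y
  | simpleRefl_mul x i _ hiJ h ih => exact T_simpleRefl_mul h ▸ (hy i hiJ).mul_right ih

/-- `d` has no left descent in `J`; see `isDistinguished_iff` for the relation to lengths. -/
def IsDistinguished (J : Set ℕ) (d : Perm (Fin n)) : Prop :=
  ∀ i : Fin (n - 1), (i : ℕ) ∈ J → d⁻¹ (lo i) < d⁻¹ (hi i)

theorem isDistinguished_one (J : Set ℕ) : IsDistinguished J (1 : Perm (Fin n)) :=
  fun i _ => lo_lt_hi i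

namespace IsDistinguished

theorem inv_lt_inv (hd : IsDistinguished J d) {a b : Fin n} (hab : a < b)
    (h : ∀ j : ℕ, (a : ℕ) ≤ j → j < b → j ∈ J) : d⁻¹ a < d⁻¹ b := by
  obtain ⟨a, ha⟩ := a
  obtain ⟨b, hb⟩ := b
  simp only [Fin.mk_lt_mk] at hab h
  induction b, hab using Nat.le_induction with
  | base => exact hd ⟨a, by omega⟩ (h a le_rfl (by omega))
  | succ b hab ih =>
    exact (ih (by omega) fun j haj hjb => h j haj (by omega)).trans
      (hd ⟨b, by omega⟩ (h b (by omega) (by omega)))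

theorem mul_inv_lo_lt_mul_inv_hi (hd : IsDistinguished J d) (hx : x ∈ young n J)
    (hiJ : (i : ℕ) ∈ J) (h : x⁻¹ (lo i) < x⁻¹ (hi i)) :
    (x * d)⁻¹ (lo i) < (x * d)⁻¹ (hi i) := by
  rw [mul_inv_rev, Perm.mul_apply, Perm.mul_apply]
  refine hd.inv_lt_inv h fun j hlo hhi => ?_
  by_contra hj
  have hij : (i : ℕ) ≤ j := (inv_mem hx j hj (lo i)).1 hlo
  have hji : ¬(i : ℕ) + 1 ≤ j := mt (inv_mem hx j hj (hi i)).2 hhi.not_ge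
  exact hj ((show j = i by omega) ▸ hiJ)

theorem T_mul (hd : IsDistinguished J d) (hx : x ∈ young n J) : T (x * d) = T x * T d := by
  induction hx using young_induction with
  | one => simp
  | simpleRefl_mul x i hx hiJ h ih =>
    rw [mul_assoc, T_simpleRefl_mul (hd.mul_inv_lo_lt_mul_inv_hi hx hiJ h), ih,
      T_simpleRefl_mul h, mul_assoc]

theorem T_mul_inv (hd : IsDistinguished J d) (hx : x ∈ young n J) :
    T (x * d)⁻¹ = T d⁻¹ * T x⁻¹ := by
  induction hx using young_induction with
  | one => simp
  | simpleRefl_mul x i hx hiJ h ih =>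
    rw [mul_assoc, mul_inv_rev, simpleRefl_inv,
      T_mul_simpleRefl (hd.mul_inv_lo_lt_mul_inv_hi hx hiJ h), ih, mul_inv_rev, simpleRefl_inv,
      T_mul_simpleRefl h, mul_assoc]

theorem length_mul (hd : IsDistinguished J d) (hx : x ∈ young n J) :
    length (x * d) = length x + length d := by
  induction hx using young_induction with
  | one => simp
  | simpleRefl_mul x i hx hiJ h ih =>
    rw [mul_assoc, length_simpleRefl_mul (hd.mul_inv_lo_lt_mul_inv_hi hx hiJ h), ih,
      length_simpleRefl_mul h, Nat.add_right_comm]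

theorem eq_one_of_mul (hd : IsDistinguished J d) (hx : x ∈ young n J)
    (hxd : IsDistinguished J (x * d)) : x = 1 := by
  refine inv_eq_one.1 (eq_one_of_forall_lo_lt_hi fun i => ?_)
  refine (lt_or_gt_lo_hi x⁻¹ i).resolve_right fun hgt => ?_
  have hiJ : (i : ℕ) ∈ J := mem_of_mem_young_of_gt (inv_mem hx) hgt
  have hlt := hd.mul_inv_lo_lt_mul_inv_hi (mul_mem (simpleRefl_mem_young hiJ) hx) hiJ
    (inv_lo_lt_inv_hi_simpleRefl_mul.2 hgt)
  rw [mul_assoc, inv_lo_lt_inv_hi_simpleRefl_mul] at hlt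
  exact lt_asymm hlt (hxd i hiJ)

end IsDistinguished

theorem isDistinguished_iff : IsDistinguished J d ↔ ∀ u ∈ young n J, length d ≤ length (u * d) := by
  refine ⟨fun hd u hu => hd.length_mul hu ▸ Nat.le_add_left _ _, fun h i hiJ => ?_⟩
  refine (lt_or_gt_lo_hi d⁻¹ i).resolve_right fun hgt => ?_
  have hle := h _ (simpleRefl_mem_young hiJ)
  rw [length_eq_length_simpleRefl_mul_add_one hgt] at hle
  omega

end Young

section RightReps

variable {K H H' : Subgroup (Perm (Fin n))} {J : Set ℕ} {d : Perm (Fin n)}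

theorem mem_rightReps :
    d ∈ rightReps K H ↔ d ∈ K ∧ ∀ u ∈ H, length d ≤ length (u * d) := by
  simp [rightReps]

theorem mem_rightReps_young :
    d ∈ rightReps K (young n J) ↔ d ∈ K ∧ IsDistinguished J d := by
  rw [mem_rightReps, isDistinguished_iff]

theorem mem_rightReps_bot : d ∈ rightReps K ⊥ ↔ d ∈ K := by simp [mem_rightReps]

theorem exists_mem_rightReps (hHK : H ≤ K) {w : Perm (Fin n)} (hw : w ∈ K) :
    ∃ x ∈ H, ∃ d ∈ rightReps K H, x * d = w := by
  obtain ⟨u, hu, hmin⟩ := Set.exists_min_image (H : Set (Perm (Fin n)))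
    (fun u => length (u * w)) (Set.toFinite _) ⟨1, one_mem H⟩
  refine ⟨u⁻¹, inv_mem hu, u * w, mem_rightReps.2 ⟨mul_mem (hHK hu) hw, fun v hv => ?_⟩, by simp⟩
  rw [← mul_assoc]
  exact hmin _ (mul_mem hv hu)

theorem sum_rightReps_bot_of_young_le {M : Type*} [AddCommMonoid M] (hJK : young n J ≤ K)
    (F : Perm (Fin n) → M) :
    ∑ w ∈ rightReps K ⊥, F w =
      ∑ d ∈ rightReps K (young n J), ∑ x ∈ rightReps (young n J) ⊥, F (x * d) := by
  rw [← Finset.sum_product']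
  refine (Finset.sum_bij (fun p _ => p.2 * p.1) ?_ ?_ ?_ fun _ _ => rfl).symm
  · rintro ⟨d, x⟩ h
    rw [Finset.mem_product, mem_rightReps_young, mem_rightReps_bot] at h
    exact mem_rightReps_bot.2 (mul_mem (hJK h.2) h.1.1)
  · rintro ⟨d, x⟩ h ⟨d', x'⟩ h' (heq : x * d = x' * d')
    simp only [Finset.mem_product, mem_rightReps_young, mem_rightReps_bot] at h h'
    have hd' : d' = x'⁻¹ * x * d := by rw [mul_assoc, heq, inv_mul_cancel_left]
    have hxx' := h.1.2.eq_one_of_mul (mul_mem (inv_mem h'.2) h.2) (hd' ▸ h'.1.2)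
    rw [hxx', one_mul] at hd'
    rw [hd', inv_mul_eq_one.1 hxx']
  · intro w hw
    obtain ⟨x, hx, d, hd, rfl⟩ := exists_mem_rightReps hJK (mem_rightReps_bot.1 hw)
    exact ⟨(d, x), Finset.mem_product.2 ⟨hd, mem_rightReps_bot.2 hx⟩, rfl⟩

theorem sum_rightReps_bot_map {M : Type*} [AddCommMonoid M] {c : Perm (Fin n) ≃* Perm (Fin n)}
    (hc : ∀ x, c x ∈ H' ↔ x ∈ H) (F : Perm (Fin n) → M) :
    ∑ x ∈ rightReps H ⊥, F (c x) = ∑ y ∈ rightReps H' ⊥, F y :=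
  Finset.sum_equiv c.toEquiv (fun x => by simp [mem_rightReps_bot, hc]) fun _ _ => rfl

theorem sum_rightReps_bot_inv {M : Type*} [AddCommMonoid M] (F : Perm (Fin n) → M) :
    ∑ x ∈ rightReps H ⊥, F x⁻¹ = ∑ x ∈ rightReps H ⊥, F x :=
  Finset.sum_equiv (Equiv.inv _) (fun x => by simp [mem_rightReps_bot]) fun _ _ => rfl

theorem relNorm_bot_trans (hJK : young n J ≤ K) (h : Hecke n) :
    relNorm K ⊥ h = relNorm K (young n J) (relNorm (young n J) ⊥ h) := by
  simp only [relNorm, Finset.mul_sum, Finset.sum_mul]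
  rw [sum_rightReps_bot_of_young_le hJK]
  refine Finset.sum_congr rfl fun d hd => Finset.sum_congr rfl fun x hx => ?_
  have hdJ := (mem_rightReps_young.1 hd).2
  rw [hdJ.T_mul (mem_rightReps_bot.1 hx), hdJ.T_mul_inv (mem_rightReps_bot.1 hx)]
  simp only [mul_assoc]

theorem relNorm_mul_left {y : Hecke n} (hy : ∀ x ∈ K, Commute y (T x)) (h : Hecke n) :
    relNorm K H (y * h) = y * relNorm K H h := by
  rw [relNorm, relNorm, Finset.mul_sum]
  refine Finset.sum_congr rfl fun d hd => ?_
  rw [← mul_assoc, ← (hy _ (inv_mem (mem_rightReps.1 hd).1)).eq]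
  simp only [mul_assoc]

theorem relNorm_mul_right {y : Hecke n} (hy : ∀ x ∈ K, Commute y (T x)) (h : Hecke n) :
    relNorm K H (h * y) = relNorm K H h * y := by
  rw [relNorm, relNorm, Finset.sum_mul]
  refine Finset.sum_congr rfl fun d hd => ?_
  rw [← mul_assoc, mul_assoc _ y, (hy _ (mem_rightReps.1 hd).1).eq, ← mul_assoc]

theorem relNorm_young_self (J : Set ℕ) (h : Hecke n) : relNorm (young n J) (young n J) h = h := by
  have hreps : rightReps (young n J) (young n J) = {1} := by
    ext d
    rw [mem_rightReps_young, Finset.mem_singleton]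
    refine ⟨fun ⟨hdJ, hd⟩ => ?_, fun h => h ▸ ⟨one_mem _, isDistinguished_one J⟩⟩
    exact (isDistinguished_one J).eq_one_of_mul hdJ ((mul_one d).symm ▸ hd)
  simp [relNorm, hreps]

theorem relNorm_bot_mul_of_intertwine {t h h' : Hecke n} {c : Perm (Fin n) ≃* Perm (Fin n)}
    (hc : ∀ x, c x ∈ H' ↔ x ∈ H) (ht : ∀ x ∈ H, T x * t = t * T (c x)) (hh : h * t = t * h') :
    relNorm H ⊥ h * t = t * relNorm H' ⊥ h' := by
  rw [relNorm, relNorm, ← sum_rightReps_bot_map hc, Finset.sum_mul, Finset.mul_sum]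
  refine Finset.sum_congr rfl fun x hx => ?_
  have hxH := mem_rightReps_bot.1 hx
  rw [mul_assoc, ht x hxH, mul_assoc, ← mul_assoc h, hh, ← mul_assoc, ← mul_assoc,
    ht _ (inv_mem hxH), map_inv]
  simp only [mul_assoc]

end RightReps

/-! ### Conditional expectations -/

/-- The conditional expectation onto the subalgebra spanned by the `T x` with `x ∈ H`, dual to its
inclusion under the trace form. As a finset, `H` is written `rightReps H ⊥`. -/
noncomputable def condExp (H : Subgroup (Perm (Fin n))) (a : Hecke n) : Hecke n :=
  ∑ x ∈ rightReps H ⊥, trace n (T x⁻¹ * a) • T x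

section CondExp

variable {H H' : Subgroup (Perm (Fin n))} {J J' : Set ℕ}

theorem commute_condExp {h : Hecke n} (hcomm : ∀ x ∈ H, Commute h (T x)) (a : Hecke n) :
    Commute h (condExp H a) :=
  Commute.sum_right _ _ _ fun x hx => (hcomm x (mem_rightReps_bot.1 hx)).smul_right _

theorem condExp_mul_of_intertwine {t : Hecke n} {c : Perm (Fin n) ≃* Perm (Fin n)}
    (hc : ∀ x, c x ∈ H' ↔ x ∈ H) (ht : ∀ x ∈ H, T x * t = t * T (c x)) (a : Hecke n) :
    condExp H (t * a) * t = t * condExp H' (a * t) := by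
  rw [condExp, condExp, ← sum_rightReps_bot_map hc, Finset.sum_mul, Finset.mul_sum]
  refine Finset.sum_congr rfl fun x hx => ?_
  have hxH := mem_rightReps_bot.1 hx
  rw [smul_mul_assoc, mul_smul_comm, ht x hxH, ← mul_assoc, ht _ (inv_mem hxH), map_inv,
    mul_assoc, trace_mul_comm, mul_assoc]

theorem sum_condExp_mul_T (J : Set ℕ) (a : Hecke n) :
    ∑ d ∈ rightReps ⊤ (young n J), condExp (young n J) (a * T d⁻¹) * T d = a := by
  have expand : ∑ w ∈ rightReps ⊤ ⊥, trace n (T w⁻¹ * a) • T w = a := by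
    rw [← sum_rightReps_bot_inv]
    simpa [rightReps] using sum_trace_T_mul_smul_T_inv a
  rw [sum_rightReps_bot_of_young_le le_top] at expand
  refine Eq.trans (Finset.sum_congr rfl fun d hd => ?_) expand
  rw [condExp, Finset.sum_mul]
  refine Finset.sum_congr rfl fun x hx => ?_
  have hdJ := (mem_rightReps_young.1 hd).2
  have hxJ := mem_rightReps_bot.1 hx
  rw [hdJ.T_mul hxJ, hdJ.T_mul_inv hxJ, smul_mul_assoc, ← mul_assoc, trace_mul_comm, mul_assoc]

theorem sum_T_inv_mul_condExp (J : Set ℕ) (a : Hecke n) :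
    ∑ d ∈ rightReps ⊤ (young n J), T d⁻¹ * condExp (young n J) (T d * a) = a := by
  have expand : ∑ w ∈ rightReps ⊤ ⊥, trace n (T w * a) • T w⁻¹ = a := by
    simpa [rightReps] using sum_trace_T_mul_smul_T_inv a
  rw [sum_rightReps_bot_of_young_le le_top] at expand
  refine Eq.trans (Finset.sum_congr rfl fun d hd => ?_) expand
  rw [condExp, ← sum_rightReps_bot_inv, Finset.mul_sum]
  refine Finset.sum_congr rfl fun x hx => ?_
  have hdJ := (mem_rightReps_young.1 hd).2
  have hxJ := mem_rightReps_bot.1 hx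
  rw [hdJ.T_mul hxJ, hdJ.T_mul_inv hxJ, mul_smul_comm, inv_inv, mul_assoc]

theorem T_inv_eq_sum_mul_condExp {t s : Hecke n} {c : Perm (Fin n) ≃* Perm (Fin n)}
    (hts : t * s = 1) (hst : s * t = 1) (hc : ∀ x, c x ∈ young n J' ↔ x ∈ young n J)
    (ht : ∀ x ∈ young n J, T x * t = t * T (c x)) (d : Perm (Fin n)) :
    T d⁻¹ = ∑ d' ∈ rightReps ⊤ (young n J'),
      T d'⁻¹ * s * condExp (young n J) (t * T d' * T d⁻¹) := by
  have transport (a : Hecke n) :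
      condExp (young n J') (a * t) * s = s * condExp (young n J) (t * a) := by
    calc condExp (young n J') (a * t) * s
        = s * (t * condExp (young n J') (a * t)) * s := by rw [← mul_assoc s, hst, one_mul]
      _ = s * condExp (young n J) (t * a) := by
          rw [← condExp_mul_of_intertwine hc ht, mul_assoc, mul_assoc, hts, mul_one]
  calc T d⁻¹ = T d⁻¹ * t * s := by rw [mul_assoc, hts, mul_one]
    _ = ∑ d' ∈ rightReps ⊤ (young n J'),
          T d'⁻¹ * condExp (young n J') (T d' * (T d⁻¹ * t)) * s := by
        rw [← Finset.sum_mul, sum_T_inv_mul_condExp]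
    _ = _ := Finset.sum_congr rfl fun d' _ => by
        rw [mul_assoc, ← mul_assoc (T d'), transport, mul_assoc, mul_assoc]

theorem relNorm_top_young_eq_of_intertwine {t h h' : Hecke n} {c : Perm (Fin n) ≃* Perm (Fin n)}
    (htu : IsUnit t) (hc : ∀ x, c x ∈ young n J' ↔ x ∈ young n J)
    (ht : ∀ x ∈ young n J, T x * t = t * T (c x))
    (hcomm : ∀ x ∈ young n J, Commute h (T x)) (hh : h * t = t * h') :
    relNorm ⊤ (young n J) h = relNorm ⊤ (young n J') h' := by
  obtain ⟨⟨t, s, hts, hst⟩, rfl⟩ := htu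
  have hh' : s * h * t = h' := by rw [mul_assoc, hh, ← mul_assoc, hst, one_mul]
  calc relNorm ⊤ (young n J) h
      = ∑ d ∈ rightReps ⊤ (young n J), ∑ d' ∈ rightReps ⊤ (young n J'),
          T d'⁻¹ * s * h * (condExp (young n J) (t * T d' * T d⁻¹) * T d) := by
        refine Finset.sum_congr rfl fun d _ => ?_
        conv_lhs => rw [T_inv_eq_sum_mul_condExp hts hst hc ht d, Finset.sum_mul, Finset.sum_mul]
        refine Finset.sum_congr rfl fun d' _ => ?_
        rw [mul_assoc (T d'⁻¹ * s), ← (commute_condExp hcomm _).eq]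
        simp only [mul_assoc]
    _ = ∑ d' ∈ rightReps ⊤ (young n J'), T d'⁻¹ * s * h * (t * T d') := by
        rw [Finset.sum_comm]
        simp only [← Finset.mul_sum, sum_condExp_mul_T]
    _ = relNorm ⊤ (young n J') h' := by
        simp only [relNorm, ← hh', mul_assoc]

end CondExp

/-! ### Jucys–Murphy elements -/

/-- A sequence satisfying the braid relations of type `A` in which every term is either zero or
satisfies the quadratic relation with parameter `ξ`. Zero terms allow one sequence to encode the
generators of a Young subgroup with several blocks. -/
structure IsHeckeFamily {k R : Type*} [CommSemiring k] [Semiring R] [Algebra k R] (ξ : k)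
    (g : ℕ → R) : Prop where
  comm : ∀ i j, i + 2 ≤ j → Commute (g i) (g j)
  braid : ∀ i, g i * g (i + 1) * g i = g (i + 1) * g i * g (i + 1)
  quad : ∀ j, g j = 0 ∨ g j * g j = 1 + ξ • g j

/-- The Jucys–Murphy elements of the sequence `g`; they start afresh after every zero of `g`. -/
def jucysMurphy {R : Type*} [Semiring R] (g : ℕ → R) : ℕ → R
  | 0 => 0
  | m + 1 => g m + g m * jucysMurphy g m * g m

open Classical in
/-- The product, in increasing order of index, of the `f j` with `j ∈ J` and `j < N`. -/
noncomputable def orderedProd {M : Type*} [Monoid M] (f : ℕ → M) (J : Set ℕ) (N : ℕ) : M :=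
  (((List.range N).filter (· ∈ J)).map f).prod

section OrderedProd

variable {M : Type*} [Monoid M] {f : ℕ → M} {J : Set ℕ} {N : ℕ}

theorem orderedProd_zero (f : ℕ → M) (J : Set ℕ) : orderedProd f J 0 = 1 := rfl

theorem orderedProd_succ_of_mem (h : N ∈ J) :
    orderedProd f J (N + 1) = orderedProd f J N * f N := by
  simp [orderedProd, List.range_succ, h]

theorem orderedProd_succ_of_notMem (h : N ∉ J) :
    orderedProd f J (N + 1) = orderedProd f J N := by
  simp [orderedProd, List.range_succ, h]

theorem commute_orderedProd {y : M} (h : ∀ j ∈ J, j < N → Commute y (f j)) :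
    Commute y (orderedProd f J N) := by
  induction N with
  | zero => exact Commute.one_right y
  | succ N ih =>
    have hN := ih fun j hj hjN => h j hj (hjN.trans N.lt_succ_self)
    by_cases hNJ : N ∈ J
    · exact orderedProd_succ_of_mem (f := f) hNJ ▸ hN.mul_right (h N hNJ N.lt_succ_self)
    · exact orderedProd_succ_of_notMem (f := f) hNJ ▸ hN

end OrderedProd

section JucysMurphy

variable {k R : Type*} [CommSemiring k] [Semiring R] [Algebra k R] {ξ : k} {g : ℕ → R}

theorem commute_jucysMurphy {y : R} {m : ℕ} (h : ∀ j < m, Commute y (g j)) :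
    Commute y (jucysMurphy g m) := by
  induction m with
  | zero => exact Commute.zero_right y
  | succ m ih =>
    have hm := h m m.lt_succ_self
    exact hm.add_right ((hm.mul_right (ih fun j hj => h j (hj.trans m.lt_succ_self))).mul_right hm)

theorem commute_add_conj {a : R} (ha : a * a = 1 + ξ • a) (b : R) : Commute a (b + a * b * a) := by
  have hl : a * (b + a * b * a) = a * b + (b * a + ξ • (a * b * a)) := by
    rw [mul_add, ← mul_assoc, ← mul_assoc, ha, add_mul, add_mul, one_mul, smul_mul_assoc,
      smul_mul_assoc]
  have hr : (b + a * b * a) * a = b * a + (a * b + ξ • (a * b * a)) := by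
    rw [add_mul, mul_assoc (a * b), ha, mul_add, mul_one, mul_smul_comm]
  rw [Commute, SemiconjBy, hl, hr, add_left_comm]

theorem commute_conj_conj_of_braid {a b x : R} (hab : a * b * a = b * a * b) (hbx : Commute b x) :
    Commute a (b * (a * x * a) * b) := by
  calc a * (b * (a * x * a) * b)
      = a * b * a * x * (a * b) := by simp only [mul_assoc]
    _ = b * a * (b * x) * (a * b) := by rw [hab]; simp only [mul_assoc]
    _ = b * a * x * (b * a * b) := by rw [hbx.eq]; simp only [mul_assoc]
    _ = b * (a * x * a) * b * a := by rw [← hab]; simp only [mul_assoc]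

namespace IsHeckeFamily

theorem commute_jucysMurphy_of_lt (hg : IsHeckeFamily ξ g) {j m : ℕ} (h : m < j) :
    Commute (g j) (jucysMurphy g m) :=
  commute_jucysMurphy fun i hi => (hg.comm i j (by omega)).symm

theorem commute_jucysMurphy_add_two (hg : IsHeckeFamily ξ g) (j : ℕ) :
    Commute (g j) (jucysMurphy g (j + 2)) := by
  have expand : jucysMurphy g (j + 2) = g (j + 1) + g j * g (j + 1) * g j +
      g (j + 1) * (g j * jucysMurphy g j * g j) * g (j + 1) := by
    simp only [jucysMurphy, mul_add, add_mul, hg.braid, add_assoc]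
  have hlead : Commute (g j) (g (j + 1) + g j * g (j + 1) * g j) := by
    obtain h0 | hquad := hg.quad j
    · exact h0 ▸ Commute.zero_left _
    · exact commute_add_conj hquad _
  rw [expand]
  exact hlead.add_right <|
    commute_conj_conj_of_braid (hg.braid j) (hg.commute_jucysMurphy_of_lt j.lt_succ_self)

theorem commute_jucysMurphy_of_add_two_le (hg : IsHeckeFamily ξ g) {j m : ℕ} (h : j + 2 ≤ m) :
    Commute (g j) (jucysMurphy g m) := by
  induction m, h using Nat.le_induction with
  | base => exact hg.commute_jucysMurphy_add_two j
  | succ m hm ih =>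
    have hjm := hg.comm j m hm
    exact hjm.add_right ((hjm.mul_right ih).mul_right hjm)

theorem commute_jucysMurphy_jucysMurphy (hg : IsHeckeFamily ξ g) (i m : ℕ) :
    Commute (jucysMurphy g i) (jucysMurphy g m) := by
  wlog him : i ≤ m generalizing i m
  · exact (this m i (le_of_not_ge him)).symm
  obtain rfl | hlt := him.eq_or_lt
  · exact Commute.refl _
  · exact (commute_jucysMurphy fun j hj =>
      (hg.commute_jucysMurphy_of_add_two_le (by omega)).symm).symm

theorem commute_jucysMurphy_mul_jucysMurphy_succ (hg : IsHeckeFamily ξ g) (m : ℕ) :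
    Commute (g m) (jucysMurphy g m * jucysMurphy g (m + 1)) := by
  have hcomm := hg.commute_jucysMurphy_jucysMurphy m (m + 1)
  calc g m * (jucysMurphy g m * jucysMurphy g (m + 1))
      = g m * jucysMurphy g m * (g m + g m * jucysMurphy g m * g m) := (mul_assoc _ _ _).symm
    _ = (g m + g m * jucysMurphy g m * g m) * jucysMurphy g m * g m := by
        simp only [mul_add, add_mul, mul_assoc]
    _ = jucysMurphy g m * jucysMurphy g (m + 1) * g m := by rw [hcomm.eq, jucysMurphy]

theorem commute_orderedProd_jucysMurphy (hg : IsHeckeFamily ξ g) {J : Set ℕ}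
    (hJ : ∀ j ∉ J, g j = 0) {j N : ℕ} (hjN : j < N) :
    Commute (g j) (orderedProd (fun m => jucysMurphy g (m + 1)) J N) := by
  by_cases hj : j ∈ J
  swap
  · exact hJ j hj ▸ Commute.zero_left _
  induction N, hjN using Nat.le_induction with
  | base =>
    rw [Nat.succ_eq_add_one, orderedProd_succ_of_mem hj]
    cases j with
    | zero => simp [orderedProd_zero, jucysMurphy]
    | succ i =>
      have hlow : Commute (g (i + 1)) (orderedProd (fun m => jucysMurphy g (m + 1)) J i) :=
        commute_orderedProd fun m _ hm => hg.commute_jucysMurphy_of_lt (by omega)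
      by_cases hi : i ∈ J
      · rw [orderedProd_succ_of_mem hi, mul_assoc]
        exact hlow.mul_right (hg.commute_jucysMurphy_mul_jucysMurphy_succ (i + 1))
      · rw [orderedProd_succ_of_notMem hi]
        exact hlow.mul_right (by simp [jucysMurphy, hJ i hi])
  | succ N hN ih =>
    by_cases hNJ : N ∈ J
    · rw [orderedProd_succ_of_mem hNJ]
      exact ih.mul_right (hg.commute_jucysMurphy_of_add_two_le (by omega))
    · rwa [orderedProd_succ_of_notMem hNJ]

end IsHeckeFamily

end JucysMurphy

/-! ### Coxeter class elements as products of Jucys–Murphy elements -/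

open Classical in
/-- The generators of the Hecke algebra with index in `J`, as a sequence extended by zero. -/
noncomputable def genOn (n : ℕ) (J : Set ℕ) (j : ℕ) : Hecke n :=
  if h : j < n - 1 ∧ j ∈ J then gen ⟨j, h.1⟩ else 0

/-- The indices of `J` below `N - 1` that are followed by an index of `J`. Passing from `J` to
`innerIndices J (n - 1)` is the effect of `subOne` on index sets. -/
def innerIndices (J : Set ℕ) (N : ℕ) : Set ℕ := {j | j ∈ J ∧ j + 1 ∈ J ∧ j + 1 < N}

section GenOn

variable {J : Set ℕ}

theorem genOn_val {i : Fin (n - 1)} (hi : (i : ℕ) ∈ J) : genOn n J i = gen i :=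
  dif_pos ⟨i.2, hi⟩

theorem genOn_of_notMem {j : ℕ} (hj : j ∉ J) : genOn n J j = 0 := dif_neg fun h => hj h.2

theorem isHeckeFamily_genOn (n : ℕ) (J : Set ℕ) : IsHeckeFamily (X : ℤ[X]) (genOn n J) where
  comm i j hij := by
    unfold genOn
    split_ifs
    · exact gen_comm hij
    · exact Commute.zero_right _
    · exact Commute.zero_left _
    · exact Commute.zero_left _
  braid i := by
    unfold genOn
    split_ifs
    · exact gen_braid rfl
    all_goals simp only [mul_zero, zero_mul]
  quad j := by
    unfold genOn
    split_ifs
    · exact .inr (gen_mul_self _)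
    · exact .inl rfl

theorem commute_T_of_commute_genOn {y : Hecke n} {I : Set ℕ} (hIJ : I ⊆ J)
    (hy : ∀ i ∈ I, Commute y (genOn n J i)) {x : Perm (Fin n)} (hx : x ∈ young n I) :
    Commute y (T x) :=
  commute_T_of_mem_young (fun i hi => genOn_val (hIJ hi) ▸ hy i hi) hx

end GenOn

section InnerIndices

variable {J : Set ℕ} {N : ℕ}

theorem innerIndices_subset (J : Set ℕ) (N : ℕ) : innerIndices J N ⊆ J := fun _ h => h.1

theorem innerIndices_succ_subset (J : Set ℕ) (N : ℕ) :
    innerIndices J N ⊆ innerIndices J (N + 1) := fun _ h => ⟨h.1, h.2.1, h.2.2.trans N.lt_succ_self⟩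

theorem innerIndices_zero (J : Set ℕ) : innerIndices J 0 = ∅ := by
  ext j
  simp [innerIndices]

theorem innerIndices_one (J : Set ℕ) : innerIndices J 1 = ∅ := by
  ext j
  simp [innerIndices]

theorem innerIndices_succ_of_notMem (hN : N ∉ J) : innerIndices J (N + 1) = innerIndices J N := by
  ext j
  refine and_congr_right fun _ => and_congr_right fun hj => ?_
  have : j + 1 ≠ N := fun h => hN (h ▸ hj)
  omega

theorem innerIndices_sep (J : Set ℕ) (N : ℕ) :
    {j ∈ innerIndices J (N + 1) | j + 1 < N} = innerIndices J N := by
  ext j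
  exact ⟨fun ⟨⟨hj, hj', _⟩, hlt⟩ => ⟨hj, hj', hlt⟩,
    fun h => ⟨innerIndices_succ_subset J N h, h.2.2⟩⟩

theorem innerIndices_add_two_of_notMem (hN : N ∉ J) :
    innerIndices J (N + 2) = innerIndices J (N + 1) := by
  ext j
  refine and_congr_right fun hj => and_congr_right fun _ => ?_
  have : j ≠ N := fun h => hN (h ▸ hj)
  omega

theorem innerIndices_add_two_of_mem (hN : N ∈ J) (hN' : N + 1 ∈ J) :
    innerIndices J (N + 2) = insert N (innerIndices J (N + 1)) := by
  ext j
  rw [Set.mem_insert_iff]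
  refine ⟨fun ⟨hj, hj', hlt⟩ => ?_, ?_⟩
  · obtain rfl | hne := eq_or_ne j N
    · exact .inl rfl
    · exact .inr ⟨hj, hj', by omega⟩
  · rintro (rfl | ⟨hj, hj', hlt⟩)
    · exact ⟨hN, hN', by omega⟩
    · exact ⟨hj, hj', by omega⟩

end InnerIndices

section Insert

variable {I : Set ℕ} {m : Fin (n - 1)} {d x : Perm (Fin n)}

theorem apply_hi_eq_lo_of_gt (hI : ∀ j ∈ I, j < m) (hd : d ∈ young n (insert (m : ℕ) I))
    (hdI : IsDistinguished I d) (hgt : d⁻¹ (hi m) < d⁻¹ (lo m)) : d (hi m) = lo m := by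
  have hsucc : (m : ℕ) + 1 ∉ insert (m : ℕ) I := fun h =>
    h.elim (by omega) fun h => (hI _ h).not_ge (by omega)
  have hlo : d⁻¹ (lo m) ≤ hi m := (inv_mem hd _ hsucc (lo m)).2 (Nat.le_succ m)
  have hle : d (hi m) ≤ hi m := (hd _ hsucc (hi m)).2 le_rfl
  have hne : d (hi m) ≠ hi m := fun h => (Perm.inv_eq_iff_eq.2 h.symm ▸ hgt).not_ge hlo
  by_contra hne'
  have hlt : d (hi m) < lo m := by
    simp only [Fin.lt_def, Fin.le_def, Fin.ext_iff, ne_eq, lo_val, hi_val] at hle hne hne' ⊢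
    omega
  refine (hdI.inv_lt_inv hlt fun j hpj hjm => ?_).not_ge (by simpa using hlo)
  by_contra hj
  have hj' : j ∉ insert (m : ℕ) I := fun h => h.elim hjm.ne hj
  have hmj := (hd j hj' (hi m)).1 hpj
  rw [lo_val] at hjm
  rw [hi_val] at hmj
  omega

theorem mem_young_of_apply_hi_eq_self (hx : x ∈ young n (insert (m : ℕ) I))
    (hm : (m : ℕ) + 1 ∉ insert (m : ℕ) I) (hfix : x (hi m) = hi m) : x ∈ young n I := by
  intro j hj a
  obtain rfl | hjm := eq_or_ne j m
  · have hle := hx _ hm a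
    have heq : x a = hi m ↔ a = hi m := by rw [← x.injective.eq_iff (a := a), hfix]
    simp only [Fin.ext_iff, hi_val] at heq
    omega
  · exact hx j (fun h => h.elim hjm hj) a

theorem simpleRefl_mul_mem_young_of_gt (hI : ∀ j ∈ I, j < m) (hd : d ∈ young n (insert (m : ℕ) I))
    (hdI : IsDistinguished I d) (hgt : d⁻¹ (hi m) < d⁻¹ (lo m)) : simpleRefl m * d ∈ young n I := by
  refine mem_young_of_apply_hi_eq_self
    (mul_mem (simpleRefl_mem_young (Set.mem_insert _ _)) hd) (fun h => ?_) ?_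
  · exact h.elim (by omega) fun h => (hI _ h).not_ge (by omega)
  · rw [Perm.mul_apply, apply_hi_eq_lo_of_gt hI hd hdI hgt, simpleRefl_lo]

theorem isDistinguished_simpleRefl_mul_iff (hI : ∀ j ∈ I, j < m) (hd : d ∈ young n I) :
    IsDistinguished I (simpleRefl m * d) ↔ IsDistinguished {j ∈ I | j + 1 < m} d := by
  have hfar (i : Fin (n - 1)) (hi' : (i : ℕ) + 1 < m) :
      (simpleRefl m * d)⁻¹ (lo i) = d⁻¹ (lo i) ∧ (simpleRefl m * d)⁻¹ (hi i) = d⁻¹ (hi i) := by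
    obtain ⟨hlo, hhi⟩ := simpleRefl_apply_of_add_two_le (i := m) (j := i) (.inr (by omega))
    simp [mul_inv_rev, hlo, hhi]
  refine ⟨fun h i hi' => ?_, fun h i hi' => ?_⟩
  · rw [← (hfar i hi'.2).1, ← (hfar i hi'.2).2]
    exact h i hi'.1
  · by_cases him : (i : ℕ) + 1 < m
    · rw [(hfar i him).1, (hfar i him).2]
      exact h i ⟨hi', him⟩
    · have hmI : (m : ℕ) ∉ I := fun h => lt_irrefl _ (hI _ h)
      have him' : (i : ℕ) + 1 = m := by have := hI i hi'; omega
      have hle : (d⁻¹ (lo i) : ℕ) ≤ m := (inv_mem hd _ hmI _).2 (by rw [lo_val]; omega)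
      have hgt : ¬(d⁻¹ (hi m) : ℕ) ≤ m := mt (inv_mem hd _ hmI _).1 (by simp)
      rw [mul_inv_rev, simpleRefl_inv, Perm.mul_apply, Perm.mul_apply,
        simpleRefl_lo_of_add_one_eq him', hi_eq_lo_of_add_one_eq him', simpleRefl_lo, Fin.lt_def]
      omega

theorem rightReps_young_insert (hI : ∀ j ∈ I, j < m) :
    rightReps (young n (insert (m : ℕ) I)) (young n I) = insert 1
      ((rightReps (young n I) (young n {j ∈ I | j + 1 < m})).image (simpleRefl m * ·)) := by
  ext d
  simp only [Finset.mem_insert, Finset.mem_image, mem_rightReps_young]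
  constructor
  · rintro ⟨hd, hdI⟩
    refine or_iff_not_imp_left.2 fun hne => ?_
    obtain ⟨i, hi'⟩ : ∃ i : Fin (n - 1), d⁻¹ (hi i) < d⁻¹ (lo i) := by
      by_contra! hle
      exact hne (inv_eq_one.1 (eq_one_of_forall_lo_lt_hi fun i =>
        (lt_or_gt_lo_hi d⁻¹ i).resolve_right (hle i).not_gt))
    obtain him | hiI := mem_of_mem_young_of_gt (inv_mem hd) hi'
    swap
    · exact absurd hi' (hdI i hiI).not_gt
    obtain rfl := Fin.ext him
    have hmem := simpleRefl_mul_mem_young_of_gt hI hd hdI hi'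
    refine ⟨simpleRefl i * d, ⟨hmem, ?_⟩, simpleRefl_mul_cancel_left i d⟩
    rwa [← isDistinguished_simpleRefl_mul_iff hI hmem, simpleRefl_mul_cancel_left]
  · rintro (rfl | ⟨d, ⟨hd, hdI⟩, rfl⟩)
    · exact ⟨one_mem _, isDistinguished_one I⟩
    · exact ⟨mul_mem (simpleRefl_mem_young (Set.mem_insert _ _))
        (young_mono (Set.subset_insert _ _) hd), (isDistinguished_simpleRefl_mul_iff hI hd).2 hdI⟩

theorem relNorm_young_insert (hI : ∀ j ∈ I, j < m) (h : Hecke n) :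
    relNorm (young n (insert (m : ℕ) I)) (young n I) h =
      h + relNorm (young n I) (young n {j ∈ I | j + 1 < m}) (gen m * h * gen m) := by
  have hmI : (m : ℕ) ∉ I := fun h => lt_irrefl _ (hI _ h)
  rw [relNorm, rightReps_young_insert hI, Finset.sum_insert,
    Finset.sum_image (mul_right_injective _).injOn]
  · congr 1
    · simp
    · refine Finset.sum_congr rfl fun d hd => ?_
      have hlt : d⁻¹ (lo m) < d⁻¹ (hi m) := (lt_or_gt_lo_hi d⁻¹ m).resolve_right
        (mt (mem_of_mem_young_of_gt (inv_mem (mem_rightReps.1 hd).1)) hmI)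
      rw [mul_inv_rev, simpleRefl_inv, T_mul_simpleRefl hlt, T_simpleRefl_mul hlt]
      simp only [mul_assoc]
  · rw [Finset.mem_image]
    rintro ⟨d, hd, hd1⟩
    have hdm : simpleRefl m = d := by rw [← simpleRefl_inv, inv_eq_of_mul_eq_one_right hd1]
    have := (hdm ▸ (mem_rightReps.1 hd).1 : simpleRefl m ∈ young n I) m hmI (lo m)
    simp at this

end Insert

theorem relNorm_innerIndices_succ (n : ℕ) (J : Set ℕ) (N : ℕ) :
    relNorm (young n (innerIndices J (N + 1))) (young n (innerIndices J N)) (genOn n J N) =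
      jucysMurphy (genOn n J) (N + 1) := by
  induction N with
  | zero =>
    rw [innerIndices_one, innerIndices_zero, relNorm_young_self]
    simp [jucysMurphy]
  | succ N ih =>
    by_cases hN' : N + 1 < n - 1 ∧ N + 1 ∈ J
    swap
    · have hzero : genOn n J (N + 1) = 0 := dif_neg hN'
      simp [jucysMurphy, hzero, relNorm]
    by_cases hN : N ∈ J
    swap
    · rw [innerIndices_add_two_of_notMem hN, relNorm_young_self]
      simp [jucysMurphy, genOn_of_notMem hN]
    have hg := isHeckeFamily_genOn n J
    let m : Fin (n - 1) := ⟨N, by omega⟩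
    have hcomm : ∀ x ∈ young n (innerIndices J (N + 1)), Commute (genOn n J (N + 1)) (T x) :=
      fun x => commute_T_of_commute_genOn (innerIndices_subset J _) fun i hi' =>
        (hg.comm i (N + 1) (by have := hi'.2.2; omega)).symm
    rw [innerIndices_add_two_of_mem hN hN'.2,
      relNorm_young_insert (m := m) (fun j hj => Nat.lt_of_succ_lt_succ hj.2.2), innerIndices_sep,
      ← genOn_val (i := m) hN, hg.braid, relNorm_mul_right hcomm, relNorm_mul_left hcomm, ih,
      ← jucysMurphy]

theorem relNorm_orderedProd_genOn (n : ℕ) (J : Set ℕ) (N : ℕ) :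
    relNorm (young n (innerIndices J N)) ⊥ (orderedProd (genOn n J) J N) =
      orderedProd (fun m => jucysMurphy (genOn n J) (m + 1)) J N := by
  have hg := isHeckeFamily_genOn n J
  induction N with
  | zero =>
    rw [innerIndices_zero, ← young_empty, relNorm_young_self, orderedProd_zero, orderedProd_zero]
  | succ N ih =>
    by_cases hN : N ∈ J
    swap
    · rw [innerIndices_succ_of_notMem hN, orderedProd_succ_of_notMem hN,
        orderedProd_succ_of_notMem hN, ih]
    rw [orderedProd_succ_of_mem hN, orderedProd_succ_of_mem hN,
      relNorm_bot_trans (young_mono (innerIndices_succ_subset J N)), relNorm_mul_right, ih,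
      relNorm_mul_left, relNorm_innerIndices_succ]
    · exact fun x => commute_T_of_commute_genOn (innerIndices_subset J _) fun i hi' =>
        (hg.commute_orderedProd_jucysMurphy (fun j => genOn_of_notMem)
          (by have := hi'.2.2; omega)).symm
    · exact fun x => commute_T_of_commute_genOn (innerIndices_subset J _) fun i hi' =>
        (hg.comm i N (by have := hi'.2.2; omega)).symm

theorem commute_relNorm_orderedProd_genOn (J : Set ℕ) {x : Perm (Fin n)} (hx : x ∈ young n J) :
    Commute (relNorm (young n (innerIndices J (n - 1))) ⊥ (orderedProd (genOn n J) J (n - 1)))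
      (T x) := by
  rw [relNorm_orderedProd_genOn]
  refine commute_T_of_mem_young (fun i hi' => ?_) hx
  rw [← genOn_val hi']
  exact ((isHeckeFamily_genOn n J).commute_orderedProd_jucysMurphy
    (fun j => genOn_of_notMem) i.2).symm

theorem T_wordProd_of_pairwise_lt {l : List (Fin (n - 1))} (hl : l.Pairwise (· < ·)) :
    T (wordProd l) = (l.map gen).prod := by
  induction l using List.reverseRecOn with
  | nil => simp [wordProd]
  | append_singleton l i ih =>
    rw [List.pairwise_append] at hl
    have hmem : wordProd l ∈ young n (Set.Iio (i : ℕ)) :=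
      wordProd_mem_young fun j hj => hl.2.2 j hj i (List.mem_singleton_self i)
    have hlt : wordProd l (lo i) < wordProd l (hi i) := (lt_or_gt_lo_hi _ i).resolve_right
      (mt (mem_of_mem_young_of_gt hmem) Set.self_notMem_Iio)
    rw [wordProd_append_singleton, T_mul_simpleRefl hlt, ih hl.1]
    simp

/-! ### Compositions -/

/-- The set of the `j` with `IsSimpleOf c j`, as a set of natural numbers: `j` and `j + 1` are
positions inside one block of `c`. -/
def simpleIndices (c : Composition n) : Set ℕ :=
  {j | ∃ i < c.length, c.sizeUpTo i ≤ j ∧ j + 1 < c.sizeUpTo (i + 1)}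

/-- `j` and `j + 1` lie in the same of the consecutive intervals of natural numbers, starting at
`0`, whose lengths are the entries of `l`. -/
def IsInterior : List ℕ → ℕ → Prop
  | [], _ => False
  | a :: l, j => j + 1 < a ∨ a ≤ j ∧ IsInterior l (j - a)

theorem isInterior_iff {l : List ℕ} {j : ℕ} :
    IsInterior l j ↔ ∃ i < l.length, (l.take i).sum ≤ j ∧ j + 1 < (l.take (i + 1)).sum := by
  induction l generalizing j with
  | nil => simp [IsInterior]
  | cons a l ih =>
    rw [IsInterior, ih]
    constructor
    · rintro (h | ⟨haj, i, hi, h, h'⟩)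
      · exact ⟨0, by simp, by simp, by simpa using h⟩
      · refine ⟨i + 1, by simpa using hi, ?_, ?_⟩ <;>
          simp only [List.take_succ_cons, List.sum_cons] <;> omega
    · rintro ⟨_ | i, hi, h, h'⟩
      · exact .inl (by simpa using h')
      · simp only [List.take_succ_cons, List.sum_cons, List.length_cons] at hi h h'
        exact .inr ⟨by omega, i, by omega, by omega, by omega⟩

theorem IsInterior.add_one_lt_sum {l : List ℕ} {j : ℕ} (h : IsInterior l j) : j + 1 < l.sum := by
  induction l generalizing j with
  | nil => exact h.elim
  | cons a l ih =>
    rw [List.sum_cons]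
    obtain h | ⟨haj, h⟩ := h
    · omega
    · have := ih h
      omega

theorem isInterior_flatMap_splitOne {l : List ℕ} {j : ℕ} :
    IsInterior (l.flatMap splitOne) j ↔ IsInterior l j ∧ IsInterior l (j + 1) := by
  induction l generalizing j with
  | nil => simp [IsInterior]
  | cons a l ih =>
    rw [List.flatMap_cons, splitOne]
    by_cases haj : a ≤ j
    · have hsub : j + 1 - a = j - a + 1 := by omega
      split_ifs with ha
      · have hsub' : j - (a - 1) - 1 = j - a := by omega
        simp only [List.cons_append, List.nil_append, IsInterior, hsub, hsub', ih]
        grind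
      · simp only [List.cons_append, List.nil_append, IsInterior, hsub, ih]
        grind
    · split_ifs with ha
      · simp only [List.cons_append, List.nil_append, IsInterior]
        omega
      · simp only [List.cons_append, List.nil_append, IsInterior]
        omega

section Composition

variable (c : Composition n)

theorem simpleIndices_eq : simpleIndices c = {j | IsInterior c.blocks j} :=
  Set.ext fun _ => isInterior_iff.symm

theorem simpleIndices_subOne :
    simpleIndices (subOne c) = innerIndices (simpleIndices c) (n - 1) := by
  simp only [simpleIndices_eq]
  ext j
  refine isInterior_flatMap_splitOne.trans (and_congr_right fun _ => ?_)
  refine ⟨fun h => ⟨h, ?_⟩, And.left⟩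
  have := c.blocks_sum ▸ h.add_one_lt_sum
  omega

theorem parabolic_eq_young : parabolic c = young n (simpleIndices c) :=
  (young_eq_closure n (simpleIndices c)).symm

theorem T_coxeterElt :
    T (coxeterElt c) = orderedProd (genOn n (simpleIndices c)) (simpleIndices c) (n - 1) := by
  classical
  rw [coxeterElt, T_wordProd_of_pairwise_lt ((List.pairwise_lt_finRange _).filter _), orderedProd,
    ← List.map_coe_finRange_eq_range, List.filter_map, List.map_map]
  refine congrArg List.prod (List.map_congr_left fun i hi' => (genOn_val ?_).symm)
  exact of_decide_eq_true (List.mem_filter.1 hi').2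

theorem eta_eq_relNorm_innerIndices :
    eta c = relNorm (young n (innerIndices (simpleIndices c) (n - 1))) ⊥ (T (coxeterElt c)) := by
  rw [eta, parabolic_eq_young, simpleIndices_subOne]

theorem commute_eta_T {x : Perm (Fin n)} (hx : x ∈ young n (simpleIndices c)) :
    Commute (eta c) (T x) := by
  rw [eta_eq_relNorm_innerIndices, T_coxeterElt]
  exact commute_relNorm_orderedProd_genOn _ hx

theorem b_eq_relNorm_young : b c = relNorm ⊤ (young n (simpleIndices c)) (eta c) := by
  rw [b, parabolic_eq_young]

end Composition

/-! ### Conjugation of Coxeter elements -/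

section CoxeterElement

variable {J : Set ℕ}

theorem wordProd_lo_of_pairwise_lt {l : List (Fin (n - 1))} (hl : l.Pairwise (· < ·))
    {i : Fin (n - 1)} (hi' : i ∈ l) : wordProd l (lo i) = hi i := by
  induction l using List.reverseRecOn with
  | nil => exact absurd hi' List.not_mem_nil
  | append_singleton l k ih =>
    rw [List.pairwise_append] at hl
    have hlt : ∀ j ∈ l, j < k := fun j hj => hl.2.2 j hj k (List.mem_singleton_self k)
    rw [wordProd_append_singleton, Perm.mul_apply]
    obtain hil | hik := List.mem_append.1 hi'
    · have hik := hlt i hil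
      rw [simpleRefl_of_ne, ih hl.1 hil] <;> rw [Ne, Fin.ext_iff] <;>
        simp only [lo_val, hi_val] <;> omega
    · rw [List.mem_singleton.1 hik, simpleRefl_lo]
      have hmem : wordProd l ∈ young n (Set.Iio (k : ℕ)) := wordProd_mem_young hlt
      exact apply_eq_self_of_mem_young hmem (by simp) fun j hj => by
        simp only [hi_val, Nat.add_right_cancel_iff] at hj
        simp [hj]

theorem eq_one_of_mem_young_of_apply_lo {x : Perm (Fin n)} (hx : x ∈ young n J)
    (hfix : ∀ i : Fin (n - 1), (i : ℕ) ∈ J → x (lo i) = lo i) : x = 1 := by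
  ext a
  by_cases ha : (a : ℕ) < n - 1 ∧ (a : ℕ) ∈ J
  · exact congrArg Fin.val (hfix ⟨a, ha.1⟩ ha.2)
  by_cases hxa : (x a : ℕ) < n - 1 ∧ (x a : ℕ) ∈ J
  · exact congrArg Fin.val (x.injective (hfix ⟨x a, hxa.1⟩ hxa.2))
  have key (p q : Fin n) (hp : ¬((p : ℕ) < n - 1 ∧ (p : ℕ) ∈ J))
      (h : (p : ℕ) ∉ J → q ≤ p) : q ≤ p := by
    by_cases hpJ : (p : ℕ) ∈ J
    · have : ¬(p : ℕ) < n - 1 := fun h => hp ⟨h, hpJ⟩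
      rw [Fin.le_def]
      omega
    · exact h hpJ
  exact congrArg Fin.val <| le_antisymm (key a (x a) ha fun h => (hx a h a).2 le_rfl)
    (key (x a) a hxa fun h => (hx (x a) h a).1 le_rfl)

theorem eq_of_mem_young_of_apply_lo {x y : Perm (Fin n)} (hx : x ∈ young n J) (hy : y ∈ young n J)
    (hxy : ∀ i : Fin (n - 1), (i : ℕ) ∈ J → x (lo i) = y (lo i)) : x = y :=
  (inv_mul_eq_one.1 <| eq_one_of_mem_young_of_apply_lo (mul_mem (inv_mem hy) hx) fun i hi' => by
    rw [Perm.mul_apply, hxy i hi', Perm.inv_eq_iff_eq]).symm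

theorem coxeterElt_mem_young (c : Composition n) : coxeterElt c ∈ young n (simpleIndices c) :=
  wordProd_mem_young fun _ hi' => by classical exact of_decide_eq_true (List.mem_filter.1 hi').2

theorem coxeterElt_lo (c : Composition n) {i : Fin (n - 1)} (hi' : (i : ℕ) ∈ simpleIndices c) :
    coxeterElt c (lo i) = hi i := by
  classical
  exact wordProd_lo_of_pairwise_lt ((List.pairwise_lt_finRange _).filter _)
    (List.mem_filter.2 ⟨List.mem_finRange i, decide_eq_true hi'⟩)

end CoxeterElement

/-- `σ` maps the pairs of consecutive positions `j`, `j + 1` with `j ∈ J` to such pairs for `J'`,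
in the same order. -/
def MapsAdjacent (σ : Perm (Fin n)) (J J' : Set ℕ) : Prop :=
  ∀ i : Fin (n - 1), (i : ℕ) ∈ J →
    ∃ k : Fin (n - 1), (k : ℕ) ∈ J' ∧ σ (lo i) = lo k ∧ σ (hi i) = hi k

/-- `σ` rearranges the blocks of positions cut out by `J` into those cut out by `J'`, preserving
the order inside each block. -/
structure IsBlockIso (σ : Perm (Fin n)) (J J' : Set ℕ) : Prop where
  mapsAdjacent : MapsAdjacent σ J J'
  mapsAdjacent_inv : MapsAdjacent σ⁻¹ J' J

section BlockIso

variable {J J' : Set ℕ} {σ x : Perm (Fin n)}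

namespace MapsAdjacent

theorem isDistinguished (h : MapsAdjacent σ J J') : IsDistinguished J σ⁻¹ := by
  intro i hi'
  obtain ⟨k, -, hlo, hhi⟩ := h i hi'
  rw [inv_inv, hlo, hhi]
  exact lo_lt_hi k

theorem conj_mem (h : MapsAdjacent σ J J') (hx : x ∈ young n J) :
    MulAut.conj σ x ∈ young n J' := by
  induction hx using young_induction with
  | one => rw [map_one]; exact one_mem _
  | simpleRefl_mul x i _ hi' _ ih =>
    obtain ⟨k, hk, hlo, hhi⟩ := h i hi'
    have hconj : MulAut.conj σ (simpleRefl i) = simpleRefl k := by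
      rw [MulAut.conj_apply]
      exact (Equiv.swap_apply_apply σ (lo i) (hi i)).symm.trans (by rw [hlo, hhi]; rfl)
    rw [map_mul, hconj]
    exact mul_mem (simpleRefl_mem_young hk) ih

theorem innerIndices (h : MapsAdjacent σ J J') :
    MapsAdjacent σ (innerIndices J (n - 1)) (innerIndices J' (n - 1)) := by
  rintro i ⟨hi', hsucc, hlt⟩
  obtain ⟨k, hk, hlo, hhi⟩ := h i hi'
  obtain ⟨k', hk', hlo', -⟩ := h ⟨i + 1, hlt⟩ hsucc
  have hkk' : (k : ℕ) + 1 = k' := congrArg Fin.val (hhi.symm.trans hlo')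
  exact ⟨k, ⟨hk, hkk' ▸ hk', hkk' ▸ k'.2⟩, hlo, hhi⟩

end MapsAdjacent

namespace IsBlockIso

theorem symm (h : IsBlockIso σ J J') : IsBlockIso σ⁻¹ J' J :=
  ⟨h.mapsAdjacent_inv, (inv_inv σ).symm ▸ h.mapsAdjacent⟩

theorem innerIndices (h : IsBlockIso σ J J') :
    IsBlockIso σ (innerIndices J (n - 1)) (innerIndices J' (n - 1)) :=
  ⟨h.mapsAdjacent.innerIndices, h.mapsAdjacent_inv.innerIndices⟩

theorem conj_mem_iff (h : IsBlockIso σ J J') : MulAut.conj σ x ∈ young n J' ↔ x ∈ young n J :=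
  ⟨fun hx => by simpa [mul_assoc] using h.mapsAdjacent_inv.conj_mem hx, h.mapsAdjacent.conj_mem⟩

theorem T_mul_T_inv (h : IsBlockIso σ J J') (hx : x ∈ young n J) :
    T x * T σ⁻¹ = T σ⁻¹ * T (MulAut.conj σ x) := by
  have hinv := h.mapsAdjacent_inv.isDistinguished.T_mul_inv (inv_mem (h.conj_mem_iff.2 hx))
  rw [inv_inv, inv_inv] at hinv
  rw [← h.mapsAdjacent.isDistinguished.T_mul hx, ← hinv, MulAut.conj_apply]
  congr 1
  group

theorem conj_coxeterElt {α β : Composition n}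
    (h : IsBlockIso σ (simpleIndices α) (simpleIndices β)) :
    MulAut.conj σ (coxeterElt α) = coxeterElt β := by
  refine eq_of_mem_young_of_apply_lo (h.mapsAdjacent.conj_mem (coxeterElt_mem_young α))
    (coxeterElt_mem_young β) fun k hk => ?_
  obtain ⟨i, hi', hlo, hhi⟩ := h.mapsAdjacent_inv k hk
  rw [coxeterElt_lo β hk, MulAut.conj_apply, Perm.mul_apply, Perm.mul_apply, hlo,
    coxeterElt_lo α hi', Perm.inv_eq_iff_eq.1 hhi]

theorem eta_mul_T_inv {α β : Composition n}
    (h : IsBlockIso σ (simpleIndices α) (simpleIndices β)) :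
    eta α * T σ⁻¹ = T σ⁻¹ * eta β := by
  rw [eta_eq_relNorm_innerIndices, eta_eq_relNorm_innerIndices]
  exact relNorm_bot_mul_of_intertwine (fun _ => h.innerIndices.conj_mem_iff)
    (fun _ => h.innerIndices.T_mul_T_inv)
    (h.conj_coxeterElt ▸ h.T_mul_T_inv (coxeterElt_mem_young α))

end IsBlockIso

end BlockIso

section Conjugate

variable {α β : Composition n}

theorem exists_embedding_of_mem_simpleIndices {i : Fin (n - 1)}
    (hi' : (i : ℕ) ∈ simpleIndices α) :
    ∃ (b : Fin α.length) (k : ℕ) (hk : k + 1 < α.blocksFun b),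
      lo i = α.embedding b ⟨k, by omega⟩ ∧ hi i = α.embedding b ⟨k + 1, hk⟩ := by
  obtain ⟨b, hb, hle, hlt⟩ := hi'
  have hsucc : α.sizeUpTo (b + 1) = α.sizeUpTo b + α.blocksFun ⟨b, hb⟩ := α.sizeUpTo_succ' ⟨b, hb⟩
  refine ⟨⟨b, hb⟩, i - α.sizeUpTo b, by omega, Fin.ext ?_, Fin.ext ?_⟩ <;>
    simp only [lo_val, hi_val, Composition.coe_embedding] <;> omega

theorem mapsAdjacent_of_embedding {σ : Perm (Fin n)} {e : Fin α.length → Fin β.length}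
    (he : ∀ b, α.blocksFun b = β.blocksFun (e b))
    (hσ : ∀ b k, σ (α.embedding b k) = β.embedding (e b) (Fin.cast (he b) k)) :
    MapsAdjacent σ (simpleIndices α) (simpleIndices β) := by
  intro i hi'
  obtain ⟨b, k, hk, hlo, hhi⟩ := exists_embedding_of_mem_simpleIndices hi'
  have hlo' := congrArg Fin.val (hlo ▸ hσ b ⟨k, by omega⟩)
  have hhi' := congrArg Fin.val (hhi ▸ hσ b ⟨k + 1, hk⟩)
  simp only [Composition.coe_embedding, Fin.val_cast] at hlo' hhi'
  have := (σ (hi i)).2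
  have hsucc := β.sizeUpTo_succ' (e b)
  have hb := he b
  exact ⟨⟨σ (lo i), by omega⟩, ⟨e b, (e b).2, by simp only; omega, by simp only; omega⟩, rfl,
    Fin.ext (by simp only [hi_val]; omega)⟩

theorem Conjugate.exists_equiv (h : Conjugate α β) :
    ∃ e : Fin α.length ≃ Fin β.length, ∀ b, α.blocksFun b = β.blocksFun (e b) :=
  ⟨⟨h.idxBij, h.symm.idxBij, h.idxBij_rightInverse_idxBij_symm,
    h.idxBij_leftInverse_idxBij_symm⟩, fun b => (h.getElem_idxBij_eq_getElem b).symm⟩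

theorem exists_perm_apply_embedding {e : Fin α.length ≃ Fin β.length}
    (he : ∀ b, α.blocksFun b = β.blocksFun (e b)) :
    ∃ σ : Perm (Fin n), ∀ b k, σ (α.embedding b k) = β.embedding (e b) (Fin.cast (he b) k) := by
  let σ : (Σ b, Fin (α.blocksFun b)) ≃ Σ b, Fin (β.blocksFun b) :=
    Equiv.sigmaCongr e fun b => finCongr (he b)
  exact ⟨α.blocksFinEquiv.symm.trans (σ.trans β.blocksFinEquiv), fun b k =>
    congrArg (fun p => β.blocksFinEquiv (σ p)) (α.blocksFinEquiv.symm_apply_apply ⟨b, k⟩)⟩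

theorem Conjugate.exists_isBlockIso (h : Conjugate α β) :
    ∃ σ : Perm (Fin n), IsBlockIso σ (simpleIndices α) (simpleIndices β) := by
  obtain ⟨e, he⟩ := h.exists_equiv
  obtain ⟨σ, hσ⟩ := exists_perm_apply_embedding he
  have he' (b : Fin β.length) : β.blocksFun b = α.blocksFun (e.symm b) := by
    rw [he, Equiv.apply_symm_apply]
  refine ⟨σ, mapsAdjacent_of_embedding he hσ, mapsAdjacent_of_embedding he' fun b k => ?_⟩
  rw [Perm.inv_eq_iff_eq, hσ, Fin.ext_iff]
  simp only [Composition.coe_embedding, Equiv.apply_symm_apply, Fin.val_cast]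

end Conjugate

end HeckeNorm

theorem mainTheorem9 (n : ℕ) (α β : Composition n) (h : HeckeNorm.Conjugate α β) :
    HeckeNorm.b α = HeckeNorm.b β := by
  open HeckeNorm in
  obtain ⟨σ, hσ⟩ := h.exists_isBlockIso
  rw [b_eq_relNorm_young, b_eq_relNorm_young]
  exact relNorm_top_young_eq_of_intertwine (isUnit_T σ⁻¹) (fun _ => hσ.conj_mem_iff)
    (fun _ => hσ.T_mul_T_inv) (fun _ => commute_eta_T α) hσ.eta_mul_T_inv
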